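/- A function $\varphi\in H^1_{loc}(\mathbb R)$ is (the profile of) a traveling wave $u(x,t)=\varphi(x-ct)$ of $u_t-u_{xxt}=uu_{xxx}+2u_xu_{xx}-3u^2u_x$ if, for some $a\in\mathbb R$, $$(\varphi')^2+2\varphi^3-2c\varphi=((\varphi-c)^2)''+a\quad\text{in the sense of distributions.}$$ Call a continuous $\varphi$ with maximum $c$ *peaked* (resp. *cusped*) if it is $C^\infty$ on $\{\varphi\ne c\}$ and at each point where $\varphi=c$ the one-sided limits of $\varphi'$ are finite, nonzero and opposite (resp. infinite and opposite). "Decays to $m$" means $\varphi(\xi)\to m$ exponentially as $\xi\to\pm\infty$. A cusped wave has *parameter* $M$ if there are $a,d\in\mathbb R$ with $(\varphi')^2=P(\varphi)/(c-\varphi)$ where $\varphi\neq c$, $P(y)=y^2(c-y^2/2)+ay+d$, and $P(M)=0$. A traveling wave $\varphi$ with speed $c$ *corresponds to* $(m,M,c)\in\mathbb R^3$ in the following cases. (I) There is $z\in\mathbb C\setminus\mathbb R$ with $\operatorname{Re}z=-(m+M)/2$ and $m^2+M^2-|z|^2+mM-2c=0$, and - (a) $m<M<c$ and $\varphi$ is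 smooth and periodic with $\min\varphi=m$, $\max\varphi=M$; or - (b) $m<M=c$ and $\varphi$ is periodic and peaked with $\min\varphi=m$, $\max\varphi=M$; or - (c) $m<c<M$ and $\varphi$ is periodic and cusped with $\min\varphi=m$, $\max\varphi=c$ and parameter $M$. (II) There are $r,z\in\mathbb R$ with $z=-m-r-M$ and $r^2+m^2+M^2+rm+rM+mM-2c=0$, and - (a) $z<r<m<M<c$ and $\varphi$ is smooth and periodic with $\min\varphi=m$, $\max\varphi=M$; or - (b) $z<r=m<M<c$ and $\varphi$ is smooth with $\inf\varphi=m$, $\max\varphi=M$ and decays to $m$; or - (c) (kinks) $z=m<M=r<c$ and $\varphi$ is smooth with $\inf\varphi=m$, $\sup\varphi=M$, and $\varphi\to M$ as $\xi\to+\infty$, $\varphi\to m$ as $\xi\to-\infty$, both exponentially; or - (d) $z<r<m<M=c$ and $\varphi$ is periodic and peaked with $\min\varphi=m$, $\max\varphi=M$; or - (e) $z<r=m<M=c$ and $\varphi$ is peaked with $\inf\varphi=m$, $\max\varphi=M$ and decays to $m$; or - (f) $z<r<m<c<M$ and $\varphi$ is periodic and cusped with $\min\varphi=m$, $\max\varphi=c$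 and parameter $M$; or - (g) $z<r=m<c<M$ and $\varphi$ is cusped with $\inf\varphi=m$, $\max\varphi=c$ and parameter $M$, and decays to $m$. **Theorem.** Let $\varphi_i$ ($i\ge1$) and $\varphi$ be traveling waves corresponding to $(m_i,M_i,c_i)$ and $(m,M,c)$, translated so that they all have a crest (a global maximum) at $\xi=0$; kinks, which have no crest, are instead translated so that $\varphi(0)=(m+M)/2$ (and likewise $\varphi_i(0)=(m_i+M_i)/2$). If $(m_i,M_i,c_i)\to(m,M,c)$, then $\varphi_i\to\varphi$ in $H^1_{loc}(\mathbb R)$, and in particular $\varphi_i\to\varphi$ uniformly on compact sets. -/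

import Mathlib

open Set Filter Topology MeasureTheory
open scoped ContDiff

namespace MCH

/-- Square integrable on every bounded interval. -/
def MemL2loc (f : ℝ → ℝ) : Prop :=
  ∀ R : ℝ, MemLp f 2 (volume.restrict (Icc (-R) R))

/-- Test functions on the real line. -/
def IsTest (ψ : ℝ → ℝ) : Prop := ContDiff ℝ ∞ ψ ∧ HasCompactSupport ψ

/-- `g` is the weak (distributional) derivative of `f`. -/
def IsWeakDeriv (f g : ℝ → ℝ) : Prop :=
  LocallyIntegrable f volume ∧ LocallyIntegrable g volume ∧
    ∀ ψ : ℝ → ℝ, IsTest ψ → ∫ x, f x * deriv ψ x = - ∫ x, g x * ψ x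

/-- `f ∈ H¹_loc(ℝ)` with weak derivative `g`. -/
def IsH1locWith (f g : ℝ → ℝ) : Prop := MemL2loc f ∧ MemL2loc g ∧ IsWeakDeriv f g

/-- Convergence in `H¹_loc(ℝ)`: the functions belong to `H¹_loc(ℝ)`, and on every bounded interval
they and their weak derivatives converge in `L²`. -/
def TendstoH1loc (f : ℕ → ℝ → ℝ) (f₀ : ℝ → ℝ) : Prop :=
  ∃ (g : ℕ → ℝ → ℝ) (g₀ : ℝ → ℝ), (∀ i, IsH1locWith (f i) (g i)) ∧ IsH1locWith f₀ g₀ ∧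
    ∀ R : ℝ,
      Tendsto (fun i => eLpNorm (f i - f₀) 2 (volume.restrict (Icc (-R) R))) atTop (𝓝 0) ∧
      Tendsto (fun i => eLpNorm (g i - g₀) 2 (volume.restrict (Icc (-R) R))) atTop (𝓝 0)

/-- `φ ∈ H¹_loc(ℝ)` is (the profile of) a traveling wave with speed `c` of
`u_t - u_xxt = u u_xxx + 2 u_x u_xx - 3 u² u_x`: for some real `a`,
`(φ')² + 2 φ³ - 2 c φ = ((φ - c)²)'' + a` in the sense of distributions. -/
def IsTravelingWave (c : ℝ) (φ : ℝ → ℝ) : Prop :=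
  ∃ g : ℝ → ℝ, IsH1locWith φ g ∧ ∃ a : ℝ, ∀ ψ : ℝ → ℝ, IsTest ψ →
    ∫ x, (g x ^ 2 + 2 * φ x ^ 3 - 2 * c * φ x) * ψ x =
      (∫ x, (φ x - c) ^ 2 * deriv (deriv ψ) x) + ∫ x, a * ψ x

/-! ### Shapes -/

def IsPeriodic (φ : ℝ → ℝ) : Prop := ∃ L : ℝ, 0 < L ∧ Function.Periodic φ L

/-- `φ(ξ) → l` exponentially fast as `ξ → +∞`. -/
def ExpTendsTop (φ : ℝ → ℝ) (l : ℝ) : Prop :=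
  ∃ C κ : ℝ, 0 < κ ∧ ∀ᶠ ξ in atTop, |φ ξ - l| ≤ C * Real.exp (-κ * ξ)

/-- `φ(ξ) → l` exponentially fast as `ξ → -∞`. -/
def ExpTendsBot (φ : ℝ → ℝ) (l : ℝ) : Prop := ExpTendsTop (fun ξ => φ (-ξ)) l

/-- The one-sided limits of `φ'` at `x` are finite, nonzero and opposite. -/
def HasPeak (φ : ℝ → ℝ) (x : ℝ) : Prop :=
  ∃ b : ℝ, b ≠ 0 ∧ Tendsto (deriv φ) (𝓝[<] x) (𝓝 b) ∧ Tendsto (deriv φ) (𝓝[>] x) (𝓝 (-b))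

/-- The one-sided limits of `φ'` at `x` are infinite and opposite. -/
def HasCusp (φ : ℝ → ℝ) (x : ℝ) : Prop :=
  (Tendsto (deriv φ) (𝓝[<] x) atTop ∧ Tendsto (deriv φ) (𝓝[>] x) atBot) ∨
  (Tendsto (deriv φ) (𝓝[<] x) atBot ∧ Tendsto (deriv φ) (𝓝[>] x) atTop)

/-- `φ` is continuous with maximum `c`, smooth off its crests, and has a peak at every crest. -/
def IsPeaked (c : ℝ) (φ : ℝ → ℝ) : Prop :=
  Continuous φ ∧ IsGreatest (range φ) c ∧ ContDiffOn ℝ ∞ φ {ξ | φ ξ ≠ c} ∧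
    ∀ ξ, φ ξ = c → HasPeak φ ξ

/-- `φ` is continuous with maximum `c`, smooth off its crests, and has a cusp at every crest. -/
def IsCusped (c : ℝ) (φ : ℝ → ℝ) : Prop :=
  Continuous φ ∧ IsGreatest (range φ) c ∧ ContDiffOn ℝ ∞ φ {ξ | φ ξ ≠ c} ∧
    ∀ ξ, φ ξ = c → HasCusp φ ξ

/-- The polynomial `P(y) = y² (c - y²/2) + a y + d`. -/
noncomputable def waveP (c a d y : ℝ) : ℝ := y ^ 2 * (c - y ^ 2 / 2) + a * y + d

/-- The meaning of the parameter `M` of a cuspon, whose maximum is `c` rather than `M`: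
off the crests the wave satisfies `(φ')² = P(φ) / (c - φ)`, and `M` is a zero of `P`. -/
def CusponParameter (M c : ℝ) (φ : ℝ → ℝ) : Prop :=
  ∃ a d : ℝ, waveP c a d M = 0 ∧
    ∀ ξ, φ ξ ≠ c → deriv φ ξ ^ 2 = waveP c a d (φ ξ) / (c - φ ξ)

def IsSmoothPeriodicWave (m M c : ℝ) (φ : ℝ → ℝ) : Prop :=
  IsTravelingWave c φ ∧ IsPeriodic φ ∧ ContDiff ℝ ∞ φ ∧
    IsLeast (range φ) m ∧ IsGreatest (range φ) M

def IsSmoothDecayWave (m M c : ℝ) (φ : ℝ → ℝ) : Prop :=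
  IsTravelingWave c φ ∧ ContDiff ℝ ∞ φ ∧ IsGLB (range φ) m ∧ IsGreatest (range φ) M ∧
    ExpTendsTop φ m ∧ ExpTendsBot φ m

def IsKinkWave (m M c : ℝ) (φ : ℝ → ℝ) : Prop :=
  IsTravelingWave c φ ∧ ContDiff ℝ ∞ φ ∧ IsGLB (range φ) m ∧ IsLUB (range φ) M ∧
    ExpTendsTop φ M ∧ ExpTendsBot φ m

/-- Used with `M = c`. -/
def IsPeriodicPeakon (m c : ℝ) (φ : ℝ → ℝ) : Prop :=
  IsTravelingWave c φ ∧ IsPeriodic φ ∧ IsLeast (range φ) m ∧ IsPeaked c φ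

/-- Used with `M = c`. -/
def IsDecayPeakon (m c : ℝ) (φ : ℝ → ℝ) : Prop :=
  IsTravelingWave c φ ∧ IsGLB (range φ) m ∧ IsPeaked c φ ∧ ExpTendsTop φ m ∧ ExpTendsBot φ m

def IsPeriodicCuspon (m M c : ℝ) (φ : ℝ → ℝ) : Prop :=
  IsTravelingWave c φ ∧ IsPeriodic φ ∧ IsLeast (range φ) m ∧ IsCusped c φ ∧
    CusponParameter M c φ

def IsDecayCuspon (m M c : ℝ) (φ : ℝ → ℝ) : Prop :=
  IsTravelingWave c φ ∧ IsGLB (range φ) m ∧ IsCusped c φ ∧ ExpTendsTop φ m ∧ ExpTendsBot φ m ∧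
    CusponParameter M c φ

/-! ### The two classifications -/

/-- The waves for which `P` has, besides `m` and `M`, a pair of complex conjugate zeros `z`, `z̄`:
smooth periodic waves, periodic peakons, periodic cuspons. -/
def IsComplexTypeWave (m M c : ℝ) (φ : ℝ → ℝ) : Prop :=
  (∃ z : ℂ, z.im ≠ 0 ∧ z.re = -(m + M) / 2 ∧ m ^ 2 + M ^ 2 - ‖z‖ ^ 2 + m * M - 2 * c = 0) ∧
    ((m < M ∧ M < c ∧ IsSmoothPeriodicWave m M c φ) ∨
     (m < M ∧ M = c ∧ IsPeriodicPeakon m c φ) ∨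
     (m < c ∧ c < M ∧ IsPeriodicCuspon m M c φ))

/-- The relation between `m, M, c` and the two further real zeros `z`, `r`. -/
def RealZeros (m M c r z : ℝ) : Prop :=
  z = -m - r - M ∧ r ^ 2 + m ^ 2 + M ^ 2 + r * m + r * M + m * M - 2 * c = 0

def IsKinkOf (m M c : ℝ) (φ : ℝ → ℝ) : Prop :=
  ∃ r z : ℝ, RealZeros m M c r z ∧ z = m ∧ m < M ∧ M = r ∧ r < c ∧ IsKinkWave m M c φ

/-- The waves for which `P` has, besides `m` and `M`, two real zeros `z`, `r`: smooth periodic,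
smooth with decay, kinks, periodic peakons, peakons with decay, periodic cuspons,
cuspons with decay. -/
def IsRealTypeWave (m M c : ℝ) (φ : ℝ → ℝ) : Prop :=
  (∃ r z : ℝ, RealZeros m M c r z ∧
    ((z < r ∧ r < m ∧ m < M ∧ M < c ∧ IsSmoothPeriodicWave m M c φ) ∨
     (z < r ∧ r = m ∧ m < M ∧ M < c ∧ IsSmoothDecayWave m M c φ) ∨
     (z < r ∧ r < m ∧ m < M ∧ M = c ∧ IsPeriodicPeakon m c φ) ∨
     (z < r ∧ r = m ∧ m < M ∧ M = c ∧ IsDecayPeakon m c φ) ∨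
     (z < r ∧ r < m ∧ m < c ∧ c < M ∧ IsPeriodicCuspon m M c φ) ∨
     (z < r ∧ r = m ∧ m < c ∧ c < M ∧ IsDecayCuspon m M c φ))) ∨
  IsKinkOf m M c φ

/-- `φ` is a traveling wave corresponding to `(m, M, c)`. -/
def IsWaveOf (m M c : ℝ) (φ : ℝ → ℝ) : Prop :=
  IsComplexTypeWave m M c φ ∨ IsRealTypeWave m M c φ

/-- `φ` is translated so that it has a crest at `0`; a kink, which has no crest, is translated so
that it takes its mean level `(m + M) / 2` at `0`. -/
def IsCentered (m M c : ℝ) (φ : ℝ → ℝ) : Prop :=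
  (∀ ξ, φ ξ ≤ φ 0) ∨ (IsKinkOf m M c φ ∧ φ 0 = (m + M) / 2)

end MCH

/-! Where a wave is smooth, the weak equation holds classically and has a first integral:
$(c-\varphi)(\varphi')^2=P(\varphi)$ with $P$ a quartic in which only the coefficients $a,d$ are
free. The levels $m$ and $M$ are zeros of $P$, so $(m,M,c)$ determines $a$ and $d$. Thus
$(\varphi')^2$ and $\varphi''$ are explicit functions of $\varphi$ and of $(m,M,c)$, and
$P(y)=(M-y)G(y)$ with $G>0$ on $(m,\min(M,c)]$. All crested types become one kind of object,
`IsProfile`, with top level $\min(M,c)$; kinks turn out not to exist (`not_isKinkOf`).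

Pointwise convergence spreads from the common crest at $0$ by two mechanisms. Away from the level
$c$ the second order equation is regular, and Gronwall's inequality gives continuous dependence on
data and parameters (`tendsto_of_tendsto_uIcc`); unlike the first order equation, it causes no
trouble at the level $m$. Near a top the equation may be singular, and $M_i$ may lie on either side
of $c_i$. There one inverts the wave: the time spent between the top and depth $t$ below it is
`clock`, an integral whose integrand is $O(s^{-1/2})$ uniformly in $i$, so it depends continuously
on the parameters. Hence convergence of tops passes to nearby points and back (`tendsto_of_tops`,
`exists_tops_of_tendsto`). The set of points reached is open, closed and contains $0$ (`tracks`).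

Derivatives may be unbounded at cusps, so pointwise convergence alone does not give $L^2$
convergence. The weak equation expresses $\int(\varphi')^2\psi$ through integrals of bounded
functions of $\varphi$; hence these weighted energies converge, and with pointwise convergence this
gives strong $L^2_{loc}$ convergence of derivatives (`tendsto_integral_sq_sub`). Integration from
one point of convergence then gives locally uniform convergence. -/

namespace MCH

/-! ### Test functions and weak derivatives -/

theorem IsTest.continuous {ψ : ℝ → ℝ} (h : IsTest ψ) : Continuous ψ := h.1.continuous

theorem IsTest.deriv {ψ : ℝ → ℝ} (h : IsTest ψ) : IsTest (deriv ψ) :=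
  ⟨by simpa using h.1.iterate_deriv 1, h.2.deriv⟩

theorem IsTest.integrable {ψ : ℝ → ℝ} (h : IsTest ψ) : Integrable ψ :=
  h.continuous.integrable_of_hasCompactSupport h.2

theorem IsTest.hasDerivAt {ψ : ℝ → ℝ} (h : IsTest ψ) (x : ℝ) :
    HasDerivAt ψ (_root_.deriv ψ x) x :=
  (h.1.differentiable (by simp) x).hasDerivAt

theorem IsTest.integral_deriv_eq_zero {ψ : ℝ → ℝ} (h : IsTest ψ) :
    ∫ x, _root_.deriv ψ x = 0 := by
  have := integral_of_hasDerivAt_of_tendsto (f := ψ) (m := 0) (n := 0) h.hasDerivAt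
    h.deriv.integrable
    ((h.2.is_zero_at_infty).mono_left atBot_le_cocompact)
    ((h.2.is_zero_at_infty).mono_left atTop_le_cocompact)
  simpa using this

/-- A smooth function on an open set times a test function supported there is a test function. -/
theorem IsTest.mul_of_tsupport_subset {f ψ : ℝ → ℝ} {U : Set ℝ} (hU : IsOpen U)
    (hf : ContDiffOn ℝ ∞ f U) (h : IsTest ψ) (hs : tsupport ψ ⊆ U) :
    IsTest (fun x => f x * ψ x) := by
  have hsub : tsupport (fun x => f x * ψ x) ⊆ tsupport ψ := by
    apply closure_mono
    intro x hx
    simp only [Function.mem_support] at hx ⊢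
    exact fun h0 => hx (by rw [h0, mul_zero])
  refine ⟨contDiff_iff_contDiffAt.2 fun x => ?_,
    h.2.of_isClosed_subset (isClosed_tsupport _) hsub⟩
  by_cases hx : x ∈ tsupport ψ
  · exact (hf.contDiffAt (hU.mem_nhds (hs hx))).mul h.1.contDiffAt
  · have h0 : (fun x => f x * ψ x) =ᶠ[𝓝 x] fun _ => 0 :=
      notMem_tsupport_iff_eventuallyEq.1 fun hc => hx (hsub hc)
    exact contDiffAt_const.congr_of_eventuallyEq h0

theorem contDiffOn_deriv {f : ℝ → ℝ} {U : Set ℝ} (hU : IsOpen U) (hf : ContDiffOn ℝ ∞ f U) :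
    ContDiffOn ℝ ∞ (deriv f) U :=
  hf.deriv_of_isOpen hU (by simp)

theorem hasDerivAt_of_contDiffOn {f : ℝ → ℝ} {U : Set ℝ} (hU : IsOpen U)
    (hf : ContDiffOn ℝ ∞ f U) {x : ℝ} (hx : x ∈ U) : HasDerivAt f (deriv f x) x :=
  ((hf.contDiffAt (hU.mem_nhds hx)).differentiableAt (by simp)).hasDerivAt

theorem eq_zero_of_notMem_tsupport {ψ : ℝ → ℝ} {x : ℝ} (hx : x ∉ tsupport ψ) :
    ψ x = 0 ∧ deriv ψ x = 0 := by
  have h : ψ =ᶠ[𝓝 x] fun _ => 0 := notMem_tsupport_iff_eventuallyEq.1 hx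
  exact ⟨h.eq_of_nhds, by rw [h.deriv_eq]; simp⟩

/-- Integration by parts against a test function supported where `f` is smooth. -/
theorem integral_mul_deriv_of_tsupport_subset {f ψ : ℝ → ℝ} {U : Set ℝ} (hU : IsOpen U)
    (hf : ContDiffOn ℝ ∞ f U) (h : IsTest ψ) (hs : tsupport ψ ⊆ U) :
    ∫ x, f x * deriv ψ x = - ∫ x, deriv f x * ψ x := by
  have h1 := (h.mul_of_tsupport_subset hU hf hs).integral_deriv_eq_zero
  have hs' : tsupport (deriv ψ) ⊆ U := (tsupport_deriv_subset).trans hs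
  have i1 := (h.deriv.mul_of_tsupport_subset hU hf hs').integrable
  have i2 := (h.mul_of_tsupport_subset hU (contDiffOn_deriv hU hf) hs).integrable
  have h2 : ∀ x, deriv (fun x => f x * ψ x) x = deriv f x * ψ x + f x * deriv ψ x := by
    intro x
    by_cases hx : x ∈ tsupport ψ
    · exact ((hasDerivAt_of_contDiffOn hU hf (hs hx)).mul (h.hasDerivAt x)).deriv
    · have hx' : x ∉ tsupport (fun x => f x * ψ x) := fun hc => hx (closure_mono (fun y hy => by
        simp only [Function.mem_support] at hy ⊢
        exact fun h0 => hy (by rw [h0, mul_zero])) hc)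
      rw [(eq_zero_of_notMem_tsupport hx').2, (eq_zero_of_notMem_tsupport hx).1,
        (eq_zero_of_notMem_tsupport hx).2]
      simp
  simp_rw [h2] at h1
  rw [integral_add i2 i1] at h1
  linarith

/-- Both functions have the same integral against every test function supported in `U`, so the
fundamental lemma of the calculus of variations applies. -/
theorem IsWeakDeriv.ae_eq_deriv {f g : ℝ → ℝ} {U : Set ℝ} (hU : IsOpen U)
    (hw : IsWeakDeriv f g) (hf : ContDiffOn ℝ ∞ f U) : ∀ᵐ x, x ∈ U → g x = deriv f x := by
  have hd := contDiffOn_deriv hU hf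
  have key : ∀ᵐ x, x ∈ U → (fun x => g x - deriv f x) x = 0 := by
    refine hU.ae_eq_zero_of_integral_contDiff_smul_eq_zero ?_ ?_
    · exact (hw.2.1.locallyIntegrableOn U).sub
        (hd.continuousOn.locallyIntegrableOn hU.measurableSet)
    · intro ψ h1 h2 hs
      have hψ : IsTest ψ := ⟨h1, h2⟩
      have e1 := hw.2.2 ψ hψ
      have e2 := integral_mul_deriv_of_tsupport_subset hU hf hψ hs
      have i1 : Integrable (fun x => g x * ψ x) := by
        simpa [mul_comm] using
          hw.2.1.integrable_smul_left_of_hasCompactSupport hψ.continuous hψ.2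
      have i2 := (hψ.mul_of_tsupport_subset hU hd hs).integrable
      have : ∀ x, ψ x • (g x - deriv f x) = g x * ψ x - deriv f x * ψ x := by
        intro x; rw [smul_eq_mul]; ring
      simp_rw [this]
      rw [integral_sub i1 i2]
      linarith
  filter_upwards [key] with x hx hxU
  exact sub_eq_zero.1 (hx hxU)

/-! ### The classical equation off the crests -/

/-- The weak form of the traveling wave equation with the constant `a`. -/
def WeakWaveEq (c a : ℝ) (φ g : ℝ → ℝ) : Prop :=
  ∀ ψ : ℝ → ℝ, IsTest ψ →
    ∫ x, (g x ^ 2 + 2 * φ x ^ 3 - 2 * c * φ x) * ψ x =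
      (∫ x, (φ x - c) ^ 2 * deriv (deriv ψ) x) + ∫ x, a * ψ x

/-- Where the wave is smooth, the weak equation holds classically. -/
theorem WeakWaveEq.classical {c a : ℝ} {φ g : ℝ → ℝ} {U : Set ℝ} (hU : IsOpen U)
    (hw : IsWeakDeriv φ g) (hf : ContDiffOn ℝ ∞ φ U) (he : WeakWaveEq c a φ g) :
    ∀ x ∈ U, 2 * (c - φ x) * deriv (deriv φ) x =
      deriv φ x ^ 2 - 2 * φ x ^ 3 + 2 * c * φ x + a := by
  have hd := contDiffOn_deriv hU hf
  set E : ℝ → ℝ := fun x => deriv φ x ^ 2 + 2 * φ x ^ 3 - 2 * c * φ x with hE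
  have hEs : ContDiffOn ℝ ∞ E U := by
    have := hf; have := hd; rw [hE]; fun_prop
  set W : ℝ → ℝ := fun x => (φ x - c) ^ 2 with hW
  have hWs : ContDiffOn ℝ ∞ W U := by rw [hW]; fun_prop
  have hW1 := contDiffOn_deriv hU hWs
  have hW2 := contDiffOn_deriv hU hW1
  have has : ContDiffOn ℝ ∞ (fun _ : ℝ => a) U := contDiffOn_const
  set D : ℝ → ℝ := fun x => E x - deriv (deriv W) x - a with hD
  have hDs : ContDiffOn ℝ ∞ D U := (hEs.sub hW2).sub has
  have hae : ∀ᵐ x, x ∈ U → D x = 0 := by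
    refine hU.ae_eq_zero_of_integral_contDiff_smul_eq_zero
      (hDs.continuousOn.locallyIntegrableOn hU.measurableSet) ?_
    intro ψ h1 h2 hs
    have hψ : IsTest ψ := ⟨h1, h2⟩
    have hs' : tsupport (deriv ψ) ⊆ U := tsupport_deriv_subset.trans hs
    have e1 := integral_mul_deriv_of_tsupport_subset hU hWs hψ.deriv hs'
    have e2 := integral_mul_deriv_of_tsupport_subset hU hW1 hψ hs
    have e3 := he ψ hψ
    have e4 : ∫ x, (g x ^ 2 + 2 * φ x ^ 3 - 2 * c * φ x) * ψ x = ∫ x, E x * ψ x := by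
      refine integral_congr_ae ?_
      filter_upwards [hw.ae_eq_deriv hU hf] with x hx
      by_cases hxU : x ∈ U
      · simp only [hx hxU, hE]
      · rw [(eq_zero_of_notMem_tsupport fun hc => hxU (hs hc)).1]; simp
    have i1 := (hψ.mul_of_tsupport_subset hU hEs hs).integrable
    have i2 := (hψ.mul_of_tsupport_subset hU hW2 hs).integrable
    have i3 := (hψ.mul_of_tsupport_subset hU has hs).integrable
    have : ∀ x, ψ x • D x = E x * ψ x - deriv (deriv W) x * ψ x - a * ψ x := by
      intro x; rw [smul_eq_mul]; ring
    simp_rw [this]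
    rw [integral_sub (f := fun x => E x * ψ x - deriv (deriv W) x * ψ x) (i1.sub i2) i3,
      integral_sub i1 i2]
    rw [e4] at e3
    linarith
  have hD0 : EqOn D (fun _ => 0) U := by
    refine Measure.eqOn_open_of_ae_eq (μ := volume) ?_ hU hDs.continuousOn continuousOn_const
    exact (ae_restrict_iff' hU.measurableSet).2 hae
  intro x hx
  have hdW : ∀ y ∈ U, deriv W y = 2 * (φ y - c) * deriv φ y := by
    intro y hy
    have : HasDerivAt W _ y := ((hasDerivAt_of_contDiffOn hU hf hy).sub_const c).pow 2
    rw [this.deriv]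
    norm_num
  have hddW : deriv (deriv W) x = 2 * deriv φ x ^ 2 + 2 * (φ x - c) * deriv (deriv φ) x := by
    have h1 : deriv W =ᶠ[𝓝 x] fun y => 2 * (φ y - c) * deriv φ y :=
      (hU.eventually_mem hx).mono hdW
    rw [h1.deriv_eq]
    have : HasDerivAt (fun y => 2 * (φ y - c) * deriv φ y) _ x :=
      (((hasDerivAt_of_contDiffOn hU hf hx).sub_const c).const_mul 2).mul
        (hasDerivAt_of_contDiffOn hU hd hx)
    rw [this.deriv]
    ring
  have h0 := hD0 hx
  simp only [hD, hE, hddW] at h0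
  linarith

/-! ### The quartic, profiles and the first integral -/

/-- The cubic `P(y) / (M - y)`, where `P` is the quartic `waveP` with zeros `m` and `M`. -/
noncomputable def cofactor (m M c y : ℝ) : ℝ :=
  (y - m) * (y ^ 2 + (m + M) * y + (m ^ 2 + M ^ 2 + m * M - 2 * c)) / 2

/-- The coefficient of `y` in the quartic `waveP` with zeros `m` and `M`. -/
noncomputable def linCoeff (m M c : ℝ) : ℝ := (M + m) * ((M ^ 2 + m ^ 2) / 2 - c)

/-- `(φ')²` as a function of `φ`. -/
noncomputable def speedSq (m M c y : ℝ) : ℝ := (M - y) * cofactor m M c y / (c - y)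

/-- `φ''` as a function of `φ`. -/
noncomputable def accel (m M c y : ℝ) : ℝ :=
  (speedSq m M c y - 2 * y ^ 3 + 2 * c * y + linCoeff m M c) / (2 * (c - y))

/-- Only the affine part $ay+d$ of the quartic is free, so two distinct zeros determine it. This is
why $(m,M,c)$ fixes the equation of the wave. -/
theorem waveP_eq_of_zeros {m M c a d : ℝ} (hne : m ≠ M) (hm : waveP c a d m = 0)
    (hM : waveP c a d M = 0) :
    a = linCoeff m M c ∧ ∀ y, waveP c a d y = (M - y) * cofactor m M c y := by
  have ha : a = linCoeff m M c := by
    have h : (M - m) * (a - linCoeff m M c) = 0 := by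
      unfold waveP at hm hM; unfold linCoeff
      linear_combination hM - hm
    rcases mul_eq_zero.1 h with h | h
    · exact absurd (sub_eq_zero.1 h).symm hne
    · exact sub_eq_zero.1 h
  refine ⟨ha, fun y => ?_⟩
  unfold waveP at *; unfold cofactor; unfold linCoeff at ha
  linear_combination hm + (y - m) * ha

/-- The local description of a wave: the equations it satisfies where it is smooth, and its
position relative to its top level `min M c`. -/
structure IsProfile (m M c : ℝ) (φ : ℝ → ℝ) : Prop where
  m_lt : m < min M c
  cofactor_pos : ∀ y, m < y → y ≤ min M c → 0 < cofactor m M c y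
  continuous : Continuous φ
  ge : ∀ ξ, m ≤ φ ξ
  le : ∀ ξ, φ ξ ≤ min M c
  smooth : ContDiffOn ℝ ∞ φ {ξ | φ ξ ≠ c}
  deriv_sq : ∀ ξ, φ ξ ≠ c → deriv φ ξ ^ 2 = speedSq m M c (φ ξ)
  deriv_deriv : ∀ ξ, φ ξ ≠ c → deriv (deriv φ) ξ = accel m M c (φ ξ)
  isolated : ∀ ξ, φ ξ = min M c → ∀ᶠ η in 𝓝[≠] ξ, φ η ≠ min M c

/-- The weak equation, its classical form off the crests, and a first integral of the latter. -/
structure HasEnergy (c a d : ℝ) (φ : ℝ → ℝ) : Prop where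
  weak : ∃ g, IsH1locWith φ g ∧ WeakWaveEq c a φ g
  second : ∀ ξ, φ ξ ≠ c → 2 * (c - φ ξ) * deriv (deriv φ) ξ =
    deriv φ ξ ^ 2 - 2 * φ ξ ^ 3 + 2 * c * φ ξ + a
  first : ∀ ξ, φ ξ ≠ c → (c - φ ξ) * deriv φ ξ ^ 2 = waveP c a d (φ ξ)

theorem isOpen_ne {φ : ℝ → ℝ} (h : Continuous φ) (c : ℝ) : IsOpen {ξ | φ ξ ≠ c} :=
  isOpen_ne_fun h continuous_const

/-- The quantity conserved by the second order equation. -/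
noncomputable def energy (c a : ℝ) (φ : ℝ → ℝ) (ξ : ℝ) : ℝ :=
  (c - φ ξ) * deriv φ ξ ^ 2 - (φ ξ ^ 2 * (c - φ ξ ^ 2 / 2) + a * φ ξ)

/-- The derivative of the energy is $\varphi'$ times the difference of the two sides of the second
order equation. -/
theorem hasDerivAt_energy {c a : ℝ} {φ : ℝ → ℝ} (hc : Continuous φ)
    (hs : ContDiffOn ℝ ∞ φ {ξ | φ ξ ≠ c})
    (h : ∀ ξ, φ ξ ≠ c → 2 * (c - φ ξ) * deriv (deriv φ) ξ =
      deriv φ ξ ^ 2 - 2 * φ ξ ^ 3 + 2 * c * φ ξ + a) {ξ : ℝ} (hξ : φ ξ ≠ c) :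
    HasDerivAt (energy c a φ) 0 ξ := by
  have hU := isOpen_ne hc c
  have h1 := hasDerivAt_of_contDiffOn hU hs hξ
  have h2 := hasDerivAt_of_contDiffOn hU (contDiffOn_deriv hU hs) hξ
  have h3 : HasDerivAt (energy c a φ) _ ξ :=
    ((h1.const_sub c).mul (h2.pow 2)).sub
      (((h1.pow 2).mul (((h1.pow 2).div_const 2).const_sub c)).add (h1.const_mul a))
  convert h3 using 1
  have := h ξ hξ
  simp only [Pi.pow_apply]
  push_cast
  linear_combination (- deriv φ ξ) * this

theorem energy_const_on_Ioo {c a : ℝ} {φ : ℝ → ℝ} {x y : ℝ}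
    (h : ∀ ξ ∈ Ioo x y, HasDerivAt (energy c a φ) 0 ξ) :
    ∀ ξ ∈ Ioo x y, ∀ η ∈ Ioo x y, energy c a φ ξ = energy c a φ η := by
  intro ξ hξ η hη
  exact isOpen_Ioo.is_const_of_deriv_eq_zero isPreconnected_Ioo
    (fun z hz => (h z hz).differentiableAt.differentiableWithinAt)
    (fun z hz => (h z hz).deriv) hξ hη

theorem IsTravelingWave.hasEnergy_of_contDiff {c : ℝ} {φ : ℝ → ℝ} (h : IsTravelingWave c φ)
    (hs : ContDiff ℝ ∞ φ) (hlt : ∀ ξ, φ ξ ≠ c) : ∃ a d, HasEnergy c a d φ := by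
  obtain ⟨g, hg, a, ha⟩ := h
  have hs' : ContDiffOn ℝ ∞ φ {ξ | φ ξ ≠ c} := hs.contDiffOn
  have h2 := WeakWaveEq.classical (isOpen_ne hs.continuous c) hg.2.2 hs' ha
  have hE : ∀ ξ, energy c a φ ξ = energy c a φ 0 := fun ξ =>
    is_const_of_deriv_eq_zero
      (fun z => (hasDerivAt_energy hs.continuous hs' h2 (hlt z)).differentiableAt)
      (fun z => (hasDerivAt_energy hs.continuous hs' h2 (hlt z)).deriv) ξ 0
  refine ⟨a, energy c a φ 0, ⟨g, hg, ha⟩, h2, fun ξ _ => ?_⟩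
  rw [← hE ξ, waveP, energy]; ring

/-- Off the crests the energy is only locally constant. At a crest the one-sided slopes are finite,
so $(c-\varphi)(\varphi')^2\to0$ and the energy tends to the same value `e` from both sides. A
connectedness argument makes `e` the energy everywhere off the crests, and this value of the
constant is exactly $P(c)=0$. -/
theorem IsPeaked.hasEnergy {c : ℝ} {φ : ℝ → ℝ} (h : IsTravelingWave c φ) (hp : IsPeaked c φ) :
    ∃ a d, HasEnergy c a d φ ∧ waveP c a d c = 0 := by
  obtain ⟨g, hg, a, ha⟩ := h
  obtain ⟨hc, hmax, hs, hpk⟩ := hp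
  have h2 := WeakWaveEq.classical (isOpen_ne hc c) hg.2.2 hs ha
  have hder := fun ξ hξ => hasDerivAt_energy (ξ := ξ) hc hs h2 hξ
  set e := -(c ^ 2 * (c - c ^ 2 / 2) + a * c) with he
  -- Crests belong to `A` vacuously, so `A` can be shown open and closed in the whole line, with a
  -- crest as base point.
  set A : Set ℝ := {ξ | φ ξ ≠ c → energy c a φ ξ = e} with hA
  have hlim : ∀ ξ, φ ξ = c → ∀ (l : Filter ℝ) (b : ℝ), l ≤ 𝓝 ξ → Tendsto (deriv φ) l (𝓝 b) →
      Tendsto (energy c a φ) l (𝓝 e) := by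
    intro ξ hξ l b hl hb
    have h1 : Tendsto φ l (𝓝 c) := by
      have := (hc.tendsto ξ).mono_left hl
      rwa [hξ] at this
    have := ((tendsto_const_nhds (x := c)).sub h1).mul (hb.pow 2)
    have : Tendsto (energy c a φ) l _ := this.sub (((h1.pow 2).mul ((tendsto_const_nhds (x := c)).sub
      ((h1.pow 2).div_const 2))).add (h1.const_mul a))
    simpa [he] using this
  have hne : ∀ ξ, φ ξ = c → (∀ᶠ η in 𝓝[>] ξ, deriv φ η ≠ 0) ∧ ∀ᶠ η in 𝓝[<] ξ, deriv φ η ≠ 0 := by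
    intro ξ hξ
    obtain ⟨b, hb, h1, h3⟩ := hpk ξ hξ
    exact ⟨h3.eventually_ne (neg_ne_zero.2 hb), h1.eventually_ne hb⟩
  have hU := isOpen_ne hc c
  have hcross : ∀ ξ, φ ξ = c → (∀ᶠ η in 𝓝[>] ξ, energy c a φ η = e ∧ φ η ≠ c) ∧
      ∀ᶠ η in 𝓝[<] ξ, energy c a φ η = e ∧ φ η ≠ c := by
    intro ξ hξ
    obtain ⟨b, hb, h1, h3⟩ := hpk ξ hξ
    constructor
    · obtain ⟨u, hu, hsub⟩ := mem_nhdsGT_iff_exists_Ioo_subset.1 (hne ξ hξ).1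
      -- By Rolle, a second crest this close would create a zero of the derivative.
      have hnc : ∀ η ∈ Ioo ξ u, φ η ≠ c := by
        intro η hη hc'
        obtain ⟨z, hz, hz0⟩ := exists_deriv_eq_zero hη.1 hc.continuousOn (hξ.trans hc'.symm)
        exact hsub ⟨hz.1, hz.2.trans hη.2⟩ hz0
      have hconst := energy_const_on_Ioo (fun z hz => hder z (hnc z hz))
      filter_upwards [Ioo_mem_nhdsGT hu] with η hη
      refine ⟨?_, hnc η hη⟩
      refine tendsto_nhds_unique (f := energy c a φ) (l := 𝓝[>] ξ) ?_
        (hlim ξ hξ _ _ nhdsWithin_le_nhds h3)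
      refine tendsto_const_nhds.congr' ?_
      filter_upwards [Ioo_mem_nhdsGT hu] with z hz using hconst η hη z hz
    · obtain ⟨u, hu, hsub⟩ := mem_nhdsLT_iff_exists_Ioo_subset.1 (hne ξ hξ).2
      have hnc : ∀ η ∈ Ioo u ξ, φ η ≠ c := by
        intro η hη hc'
        obtain ⟨z, hz, hz0⟩ := exists_deriv_eq_zero hη.2 hc.continuousOn (hc'.trans hξ.symm)
        exact hsub ⟨hη.1.trans hz.1, hz.2⟩ hz0
      have hconst := energy_const_on_Ioo (fun z hz => hder z (hnc z hz))
      filter_upwards [Ioo_mem_nhdsLT hu] with η hη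
      refine ⟨?_, hnc η hη⟩
      refine tendsto_nhds_unique (f := energy c a φ) (l := 𝓝[<] ξ) ?_
        (hlim ξ hξ _ _ nhdsWithin_le_nhds h1)
      refine tendsto_const_nhds.congr' ?_
      filter_upwards [Ioo_mem_nhdsLT hu] with z hz using hconst η hη z hz
  have hloc : ∀ ξ, φ ξ ≠ c → ∀ᶠ η in 𝓝 ξ, energy c a φ η = energy c a φ ξ := by
    intro ξ hξ
    obtain ⟨l, u, hlu, hsub⟩ := mem_nhds_iff_exists_Ioo_subset.1 (hU.mem_nhds hξ)
    filter_upwards [Ioo_mem_nhds hlu.1 hlu.2] with η hη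
    exact energy_const_on_Ioo (fun z hz => hder z (hsub hz)) η hη ξ hlu
  have hopen : IsOpen A := by
    rw [isOpen_iff_mem_nhds]
    intro ξ hξ
    by_cases h : φ ξ = c
    · have := hcross ξ h
      have h4 : ∀ᶠ η in 𝓝[≠] ξ, η ∈ A := by
        rw [← nhdsLT_sup_nhdsGT, eventually_sup]
        exact ⟨this.2.mono fun η hη _ => hη.1, this.1.mono fun η hη _ => hη.1⟩
      rw [eventually_nhdsWithin_iff] at h4
      filter_upwards [h4] with η hη
      by_cases hηξ : η = ξ
      · rw [hηξ]; exact hξ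
      · exact hη hηξ
    · filter_upwards [hloc ξ h] with η hη _
      rw [hη]; exact hξ h
  have hcl : closure A ∩ univ ⊆ A := by
    rintro ξ ⟨hξ, -⟩ h
    obtain ⟨η, ⟨hη1, hη3⟩, hη2⟩ := mem_closure_iff_nhds.1 hξ _ ((hloc ξ h).and (hU.mem_nhds h))
    rw [← hη1]; exact hη2 hη3
  obtain ⟨x₀, hx₀⟩ := hmax.1
  have hall := isPreconnected_univ.subset_of_closure_inter_subset hopen
    ⟨x₀, mem_univ _, fun hc' => absurd hx₀ hc'⟩ hcl
  refine ⟨a, e, ⟨⟨g, hg, ha⟩, h2, fun ξ hξ => ?_⟩, ?_⟩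
  · rw [← hall (mem_univ ξ) hξ, waveP, energy]; ring
  · rw [he, waveP]; ring

/-- A maximum at which the one-sided limits of the derivative do not vanish is isolated. -/
theorem isolated_of_deriv_ne_zero {c : ℝ} {φ : ℝ → ℝ} (hc : Continuous φ) {ξ : ℝ} (hξ : φ ξ = c)
    (hr : ∀ᶠ η in 𝓝[>] ξ, deriv φ η ≠ 0) (hl : ∀ᶠ η in 𝓝[<] ξ, deriv φ η ≠ 0) :
    ∀ᶠ η in 𝓝[≠] ξ, φ η ≠ c := by
  rw [← nhdsLT_sup_nhdsGT, eventually_sup]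
  constructor
  · obtain ⟨u, hu, hsub⟩ := mem_nhdsLT_iff_exists_Ioo_subset.1 hl
    filter_upwards [Ioo_mem_nhdsLT hu] with η hη hc'
    obtain ⟨z, hz, hz0⟩ := exists_deriv_eq_zero hη.2 hc.continuousOn (hc'.trans hξ.symm)
    exact hsub ⟨hη.1.trans hz.1, hz.2⟩ hz0
  · obtain ⟨u, hu, hsub⟩ := mem_nhdsGT_iff_exists_Ioo_subset.1 hr
    filter_upwards [Ioo_mem_nhdsGT hu] with η hη hc'
    obtain ⟨z, hz, hz0⟩ := exists_deriv_eq_zero hη.1 hc.continuousOn (hξ.trans hc'.symm)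
    exact hsub ⟨hz.1, hz.2.trans hη.2⟩ hz0

theorem IsPeaked.isolated {c : ℝ} {φ : ℝ → ℝ} (h : IsPeaked c φ) {ξ : ℝ} (hξ : φ ξ = c) :
    ∀ᶠ η in 𝓝[≠] ξ, φ η ≠ c := by
  obtain ⟨b, hb, h1, h2⟩ := h.2.2.2 ξ hξ
  exact isolated_of_deriv_ne_zero h.1 hξ (h2.eventually_ne (neg_ne_zero.2 hb))
    (h1.eventually_ne hb)

theorem IsCusped.deriv_ne_zero {c : ℝ} {φ : ℝ → ℝ} (h : IsCusped c φ) {ξ : ℝ} (hξ : φ ξ = c) :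
    (∀ᶠ η in 𝓝[>] ξ, deriv φ η ≠ 0) ∧ ∀ᶠ η in 𝓝[<] ξ, deriv φ η ≠ 0 := by
  rcases h.2.2.2 ξ hξ with ⟨h1, h2⟩ | ⟨h1, h2⟩
  · exact ⟨h2.eventually_ne_atBot 0, h1.eventually_ne_atTop 0⟩
  · exact ⟨h2.eventually_ne_atTop 0, h1.eventually_ne_atBot 0⟩

theorem IsCusped.isolated {c : ℝ} {φ : ℝ → ℝ} (h : IsCusped c φ) {ξ : ℝ} (hξ : φ ξ = c) :
    ∀ᶠ η in 𝓝[≠] ξ, φ η ≠ c :=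
  isolated_of_deriv_ne_zero h.1 hξ (h.deriv_ne_zero hξ).1 (h.deriv_ne_zero hξ).2

/-- The first integral is part of `CusponParameter`, but its coefficient `a'` must still be
identified with the constant `a` of the weak equation. Off the crests the energy built with `a` has
derivative zero and also equals $(a'-a)\varphi+d$; a point beside a cusp, where $\varphi'\ne0$, then
gives $a=a'$. -/
theorem IsCusped.hasEnergy {M c : ℝ} {φ : ℝ → ℝ} (h : IsTravelingWave c φ) (hp : IsCusped c φ)
    (hM : CusponParameter M c φ) : ∃ a d, HasEnergy c a d φ ∧ waveP c a d M = 0 := by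
  obtain ⟨g, hg, a, ha⟩ := h
  obtain ⟨a', d, hM, h1⟩ := hM
  have hc := hp.1
  have hs := hp.2.2.1
  have hU := isOpen_ne hc c
  have h2 := WeakWaveEq.classical hU hg.2.2 hs ha
  have h1' : ∀ ξ, φ ξ ≠ c → (c - φ ξ) * deriv φ ξ ^ 2 = waveP c a' d (φ ξ) := by
    intro ξ hξ
    rw [h1 ξ hξ, mul_div_cancel₀ _ (sub_ne_zero.2 hξ.symm)]
  have haa : a = a' := by
    obtain ⟨x₀, hx₀⟩ := hp.2.1.1
    have hex : ∀ᶠ η in 𝓝[>] x₀, φ η ≠ c ∧ deriv φ η ≠ 0 :=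
      ((hp.isolated hx₀).filter_mono (nhdsWithin_mono _ fun y hy => ne_of_gt hy)).and
        (hp.deriv_ne_zero hx₀).1
    obtain ⟨ξ, hξ, hξ'⟩ := hex.exists
    have hd1 := hasDerivAt_energy hc hs h2 hξ
    have hd2 : HasDerivAt (energy c a φ) ((a' - a) * deriv φ ξ) ξ := by
      have : energy c a φ =ᶠ[𝓝 ξ] fun η => (a' - a) * φ η + d := by
        filter_upwards [hU.mem_nhds hξ] with η hη
        have := h1' η hη
        rw [waveP] at this
        rw [energy]; linear_combination this
      exact (((hasDerivAt_of_contDiffOn hU hs hξ).const_mul _).add_const d).congr_of_eventuallyEq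
        this
    have := hd1.unique hd2
    rcases mul_eq_zero.1 this.symm with h | h
    · linarith
    · exact absurd h hξ'
  subst haa
  exact ⟨a, d, ⟨⟨g, hg, ha⟩, h2, h1'⟩, hM⟩

theorem ExpTendsTop.tendsto {φ : ℝ → ℝ} {l : ℝ} (h : ExpTendsTop φ l) :
    Tendsto φ atTop (𝓝 l) := by
  obtain ⟨C, κ, hκ, h⟩ := h
  rw [tendsto_iff_dist_tendsto_zero]
  refine squeeze_zero' (Eventually.of_forall fun _ => dist_nonneg) h ?_
  have h1 : Tendsto (fun ξ : ℝ => -κ * ξ) atTop atBot :=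
    tendsto_id.const_mul_atTop_of_neg (neg_lt_zero.2 hκ)
  simpa using (Real.tendsto_exp_atBot.comp h1).const_mul C

/-- A limit at infinity off the singular level is a zero of the right side of the first order
equation. -/
theorem eq_zero_of_tendsto {c l : ℝ} {φ P : ℝ → ℝ} (hP : Continuous P) (hc : Continuous φ)
    (hs : ContDiffOn ℝ ∞ φ {ξ | φ ξ ≠ c}) (hl : l ≠ c) (ht : Tendsto φ atTop (𝓝 l))
    (h : ∀ ξ, φ ξ ≠ c → (c - φ ξ) * deriv φ ξ ^ 2 = P (φ ξ)) : P l = 0 := by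
  have hev : ∀ᶠ ξ in atTop, ∀ η, ξ ≤ η → φ η ≠ c := 
    eventually_forall_ge_atTop.2 (ht.eventually_ne hl)
  -- The mean value theorem on $[\xi,\xi+1]$ supplies points going to infinity along which the
  -- derivative tends to zero; convergence of the derivative itself is not needed.
  have hex : ∀ᶠ ξ in atTop, ∃ z, ξ < z ∧ φ z ≠ c ∧ deriv φ z = φ (ξ + 1) - φ ξ := by
    filter_upwards [hev] with ξ hξ
    obtain ⟨z, hz, hz'⟩ := exists_deriv_eq_slope φ (lt_add_one ξ) hc.continuousOn
      (fun y hy => (hasDerivAt_of_contDiffOn (isOpen_ne hc c) hs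
        (hξ y hy.1.le)).differentiableAt.differentiableWithinAt)
    exact ⟨z, hz.1, hξ z hz.1.le, by rw [hz']; simp⟩
  choose! z hz using fun ξ (h : ∃ z, ξ < z ∧ φ z ≠ c ∧ deriv φ z = φ (ξ + 1) - φ ξ) => h
  have hz1 : Tendsto z atTop atTop :=
    tendsto_atTop_mono' _ (hex.mono fun ξ h => (hz ξ h).1.le) tendsto_id
  have hz2 : Tendsto (fun ξ => φ (ξ + 1) - φ ξ) atTop (𝓝 0) := by
    simpa using (ht.comp (tendsto_atTop_add_const_right _ 1 tendsto_id)).sub ht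
  have hφz := ht.comp hz1
  have h1 : Tendsto (fun ξ => (c - φ (z ξ)) * (φ (ξ + 1) - φ ξ) ^ 2) atTop (𝓝 0) := by
    simpa using ((tendsto_const_nhds (x := c)).sub hφz).mul (hz2.pow 2)
  refine tendsto_nhds_unique ((hP.tendsto l).comp hφz) (h1.congr' ?_)
  filter_upwards [hex] with ξ hξ
  obtain ⟨-, h2, h3⟩ := hz ξ hξ
  rw [Function.comp_apply, Function.comp_apply, ← h _ h2, h3]

theorem continuous_waveP (c a d : ℝ) : Continuous (waveP c a d) := by
  unfold waveP; fun_prop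

theorem HasEnergy.waveP_bottom {m c a d : ℝ} {φ : ℝ → ℝ} (h : HasEnergy c a d φ)
    (hc : Continuous φ) (hs : ContDiffOn ℝ ∞ φ {ξ | φ ξ ≠ c}) (hm : m ≠ c) (hge : ∀ ξ, m ≤ φ ξ)
    (hb : m ∈ range φ ∨ ExpTendsTop φ m) : waveP c a d m = 0 := by
  rcases hb with ⟨ξ, hξ⟩ | hb
  · have h0 : deriv φ ξ = 0 :=
      IsLocalMin.deriv_eq_zero (Eventually.of_forall fun η => by rw [hξ]; exact hge η)
    have := h.first ξ (by rwa [hξ])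
    rw [h0, hξ] at this
    simpa using this.symm
  · exact eq_zero_of_tendsto (continuous_waveP c a d) hc hs hm hb.tendsto h.first

theorem HasEnergy.waveP_top {M c a d : ℝ} {φ : ℝ → ℝ} (h : HasEnergy c a d φ)
    (hM : M ≠ c) (hmax : IsGreatest (range φ) M) : waveP c a d M = 0 := by
  obtain ⟨ξ, hξ⟩ := hmax.1
  have h0 : deriv φ ξ = 0 :=
    IsLocalMax.deriv_eq_zero (Eventually.of_forall fun η => by
      rw [hξ]; exact hmax.2 (mem_range_self η))
  have := h.first ξ (by rwa [hξ])
  rw [h0, hξ] at this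
  simpa using this.symm

/-- A traveling wave with the profile equations, its weak equation, and a crest at `0`. -/
def IsCrestedWave (m M c : ℝ) (φ : ℝ → ℝ) : Prop :=
  IsProfile m M c φ ∧ φ 0 = min M c ∧
    ∃ g, IsH1locWith φ g ∧ WeakWaveEq c (linCoeff m M c) φ g

/-- Since $m$ and $M$ are zeros of $P$, the constants are those of `waveP_eq_of_zeros`. Tops at the
level $c$ are isolated by `hiso`; tops at $M<c$ are isolated because $\varphi''=-G(M)/(2(c-M))\neq0$
there, $G$ being the cofactor. -/
theorem HasEnergy.isCrestedWave {m M c a d : ℝ} {φ : ℝ → ℝ} (h : HasEnergy c a d φ)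
    (hm_lt : m < min M c) (hpos : ∀ y, m < y → y ≤ min M c → 0 < cofactor m M c y)
    (hc : Continuous φ) (hs : ContDiffOn ℝ ∞ φ {ξ | φ ξ ≠ c}) (hge : ∀ ξ, m ≤ φ ξ)
    (hmax : IsGreatest (range φ) (min M c)) (hcen : ∀ ξ, φ ξ ≤ φ 0)
    (hb : m ∈ range φ ∨ ExpTendsTop φ m) (hM : waveP c a d M = 0)
    (hiso : min M c = c → ∀ ξ, φ ξ = c → ∀ᶠ η in 𝓝[≠] ξ, φ η ≠ c) :
    IsCrestedWave m M c φ := by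
  have hmM : m < M := hm_lt.trans_le (min_le_left _ _)
  have hmc : m < c := hm_lt.trans_le (min_le_right _ _)
  have hm := h.waveP_bottom hc hs hmc.ne hge hb
  obtain ⟨ha, hP⟩ := waveP_eq_of_zeros hmM.ne hm hM
  have hle : ∀ ξ, φ ξ ≤ min M c := fun ξ => hmax.2 (mem_range_self ξ)
  have h1 : ∀ ξ, φ ξ ≠ c → deriv φ ξ ^ 2 = speedSq m M c (φ ξ) := by
    intro ξ hξ
    rw [speedSq, ← hP, ← h.first ξ hξ, mul_div_cancel_left₀ _ (sub_ne_zero.2 hξ.symm)]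
  have h2 : ∀ ξ, φ ξ ≠ c → deriv (deriv φ) ξ = accel m M c (φ ξ) := by
    intro ξ hξ
    rw [accel, ← h1 ξ hξ, ← ha, ← h.second ξ hξ,
      mul_div_cancel_left₀ _ (mul_ne_zero two_ne_zero (sub_ne_zero.2 hξ.symm))]
  refine ⟨⟨hm_lt, hpos, hc, hge, hle, hs, h1, h2, fun ξ hξ => ?_⟩, ?_, ?_⟩
  · by_cases hMc : min M c = c
    · rw [hMc] at hξ ⊢; exact hiso hMc ξ hξ
    · have hTM : min M c = M := (min_choice M c).resolve_right hMc
      have hMc' : M < c := lt_of_le_of_ne (min_eq_left_iff.1 hTM) (hTM ▸ hMc)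
      have hU := isOpen_ne hc c
      have hd := hasDerivAt_of_contDiffOn hU (contDiffOn_deriv hU hs)
        (show φ ξ ≠ c by rw [hξ]; exact hMc)
      have hneg : deriv (deriv φ) ξ ≠ 0 := by
        rw [h2 ξ (by rw [hξ]; exact hMc), hξ, hTM]
        have hG := hpos M hmM hTM.ge
        have : accel m M c M = - cofactor m M c M / (2 * (c - M)) := by
          unfold accel speedSq cofactor linCoeff
          rw [sub_self]; congr 1; ring
        rw [this]
        have : 0 < c - M := sub_pos.2 hMc'
        exact div_ne_zero (neg_ne_zero.2 hG.ne') (by positivity)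
      -- Near the top the derivative vanishes only at the top itself, whereas it vanishes at every
      -- other point of the top level.
      filter_upwards [hd.eventually_ne (c := 0) hneg] with η hη hη'
      exact hη (IsLocalMax.deriv_eq_zero (Eventually.of_forall fun z => by rw [hη']; exact hle z))
  · obtain ⟨x, hx⟩ := hmax.1
    exact le_antisymm (hle 0) (hx ▸ hcen x)
  · obtain ⟨g, hg, hw⟩ := h.weak
    exact ⟨g, hg, ha ▸ hw⟩

/-! ### Exclusion of kinks and reduction of all types to crested profiles -/

/-- The relations $z=m$, $r=M$ force $m=-M$ and $c=M^2$, so both zeros of $P$ are double and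
$P(y)=-(M-y)^2(y-m)^2/2\le0$. Since $\varphi<c$, the first integral gives $\varphi'=0$, and a
constant cannot have two different limits. -/
theorem not_isKinkOf {m M c : ℝ} {φ : ℝ → ℝ} : ¬ IsKinkOf m M c φ := by
  rintro ⟨r, z, ⟨hz, hrel⟩, rfl, hmM, rfl, hMc, htw, hs, hglb, hlub, htop, hbot⟩
  have hlt : ∀ ξ, φ ξ ≠ c := fun ξ => ((hlub.1 (mem_range_self ξ)).trans_lt hMc).ne
  obtain ⟨a, d, h⟩ := htw.hasEnergy_of_contDiff hs hlt
  have hs' : ContDiffOn ℝ ∞ φ {ξ | φ ξ ≠ c} := hs.contDiffOn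
  have hM := eq_zero_of_tendsto (continuous_waveP c a d) hs.continuous hs' hMc.ne htop.tendsto
    h.first
  have hm := eq_zero_of_tendsto (φ := fun ξ => φ (-ξ)) (continuous_waveP c a d)
    (hs.continuous.comp continuous_neg) ((hs.comp contDiff_neg).contDiffOn) (hmM.trans hMc).ne
    hbot.tendsto (fun ξ hξ => by
      rw [deriv_comp_neg, neg_sq]; exact h.first _ hξ)
  obtain ⟨-, hP⟩ := waveP_eq_of_zeros hmM.ne hm hM
  have hd0 : ∀ ξ, deriv φ ξ = 0 := by
    intro ξ
    have h1 := h.first ξ (hlt ξ)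
    rw [hP] at h1
    have h2 : (M - φ ξ) * cofactor z M c (φ ξ) = -((M - φ ξ) * (φ ξ - z)) ^ 2 / 2 := by
      unfold cofactor
      have : z = -M := by linarith
      subst this
      have : c = M ^ 2 := by linarith
      subst this
      ring
    have h3 : 0 < c - φ ξ := sub_pos.2 ((hlub.1 (mem_range_self ξ)).trans_lt hMc)
    have h4 : (c - φ ξ) * deriv φ ξ ^ 2 ≤ 0 := by
      rw [h1, h2]; nlinarith [sq_nonneg ((M - φ ξ) * (φ ξ - z))]
    have h5 : deriv φ ξ ^ 2 ≤ 0 := by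
      by_contra hcon
      push Not at hcon
      nlinarith [mul_pos h3 hcon]
    exact pow_eq_zero_iff two_ne_zero |>.1 (le_antisymm h5 (sq_nonneg _))
  have hconst := is_const_of_deriv_eq_zero (hs.differentiable (by simp)) hd0
  have e1 : M = φ 0 := tendsto_nhds_unique htop.tendsto
    (tendsto_const_nhds.congr fun ξ => hconst 0 ξ)
  have e2 : z = φ 0 := tendsto_nhds_unique hbot.tendsto
    (tendsto_const_nhds.congr fun ξ => hconst 0 (-ξ))
  exact hmM.ne (e2.trans e1.symm)

/-- The quadratic factor of the cofactor is $|y-z|^2$. -/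
theorem cofactor_pos_of_complex {m M c : ℝ} {z : ℂ} (h0 : z.im ≠ 0) (h1 : z.re = -(m + M) / 2)
    (h2 : m ^ 2 + M ^ 2 - ‖z‖ ^ 2 + m * M - 2 * c = 0) {y : ℝ} (hy : m < y) :
    0 < cofactor m M c y := by
  have hn : ‖z‖ ^ 2 = z.re ^ 2 + z.im ^ 2 := by
    rw [← Complex.normSq_eq_norm_sq, Complex.normSq_apply]; ring
  have h3 : cofactor m M c y = (y - m) * ((y - z.re) ^ 2 + z.im ^ 2) / 2 := by
    have : m ^ 2 + M ^ 2 + m * M - 2 * c = z.re ^ 2 + z.im ^ 2 := by linarith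
    rw [cofactor, this, h1]; ring
  have := sub_pos.2 hy
  have : 0 < z.im ^ 2 := by positivity
  rw [h3]; positivity

/-- The quadratic factor of the cofactor is $(y-r)(y-z)$, and $z<r\le m<y$. -/
theorem cofactor_pos_of_real {m M c r z : ℝ} (h : RealZeros m M c r z) (hz : z < r) (hr : r ≤ m)
    {y : ℝ} (hy : m < y) : 0 < cofactor m M c y := by
  have h3 : cofactor m M c y = (y - m) * ((y - r) * (y - z)) / 2 := by
    rw [cofactor, h.1]; linear_combination ((y - m) / 2) * h.2
  have h4 := sub_pos.2 hy
  have h5 : 0 < y - r := by linarith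
  have h6 : 0 < y - z := by linarith
  rw [h3]; positivity

theorem isCrestedWave_of_smooth {m M c : ℝ} {φ : ℝ → ℝ} (hmM : m < M) (hMc : M < c)
    (hpos : ∀ y, m < y → 0 < cofactor m M c y) (htw : IsTravelingWave c φ) (hs : ContDiff ℝ ∞ φ)
    (hglb : IsGLB (range φ) m) (hmax : IsGreatest (range φ) M) (hcen : ∀ ξ, φ ξ ≤ φ 0)
    (hb : m ∈ range φ ∨ ExpTendsTop φ m) : IsCrestedWave m M c φ := by
  obtain ⟨a, d, h⟩ := htw.hasEnergy_of_contDiff hs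
    fun ξ => ((hmax.2 (mem_range_self ξ)).trans_lt hMc).ne
  have hT : min M c = M := min_eq_left hMc.le
  exact h.isCrestedWave (hT.symm ▸ hmM) (fun y hy _ => hpos y hy) hs.continuous hs.contDiffOn
    (fun ξ => hglb.1 (mem_range_self ξ)) (hT.symm ▸ hmax) hcen hb (h.waveP_top hMc.ne hmax)
    fun hc => absurd (hT.symm.trans hc) hMc.ne

theorem isCrestedWave_of_peaked {m c : ℝ} {φ : ℝ → ℝ} (hmc : m < c)
    (hpos : ∀ y, m < y → 0 < cofactor m c c y) (htw : IsTravelingWave c φ) (hp : IsPeaked c φ)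
    (hglb : IsGLB (range φ) m) (hcen : ∀ ξ, φ ξ ≤ φ 0)
    (hb : m ∈ range φ ∨ ExpTendsTop φ m) : IsCrestedWave m c c φ := by
  obtain ⟨a, d, h, hM⟩ := hp.hasEnergy htw
  have hT : min c c = c := min_self c
  exact h.isCrestedWave (hT.symm ▸ hmc) (fun y hy _ => hpos y hy) hp.1 hp.2.2.1
    (fun ξ => hglb.1 (mem_range_self ξ)) (hT.symm ▸ hp.2.1) hcen hb hM
    fun _ ξ hξ => hp.isolated hξ

theorem isCrestedWave_of_cusped {m M c : ℝ} {φ : ℝ → ℝ} (hmc : m < c) (hcM : c < M)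
    (hpos : ∀ y, m < y → 0 < cofactor m M c y) (htw : IsTravelingWave c φ) (hp : IsCusped c φ)
    (hM : CusponParameter M c φ) (hglb : IsGLB (range φ) m) (hcen : ∀ ξ, φ ξ ≤ φ 0)
    (hb : m ∈ range φ ∨ ExpTendsTop φ m) : IsCrestedWave m M c φ := by
  obtain ⟨a, d, h, hM⟩ := hp.hasEnergy htw hM
  have hT : min M c = c := min_eq_right hcM.le
  exact h.isCrestedWave (hT.symm ▸ hmc) (fun y hy _ => hpos y hy) hp.1 hp.2.2.1
    (fun ξ => hglb.1 (mem_range_self ξ)) (hT.symm ▸ hp.2.1) hcen hb hM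
    fun _ ξ hξ => hp.isolated hξ

theorem IsWaveOf.isCrestedWave {m M c : ℝ} {φ : ℝ → ℝ} (h : IsWaveOf m M c φ)
    (hcen : IsCentered m M c φ) : IsCrestedWave m M c φ := by
  replace hcen : ∀ ξ, φ ξ ≤ φ 0 := hcen.resolve_right fun hk => not_isKinkOf hk.1
  rcases h with ⟨⟨z, h0, h1, h2⟩, h⟩ | ⟨⟨r, z, hrz, h⟩⟩ | h
  · have hpos := fun y (hy : m < y) => cofactor_pos_of_complex h0 h1 h2 hy
    rcases h with ⟨hmM, hMc, h⟩ | ⟨hmM, rfl, h⟩ | ⟨hmc, hcM, h⟩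
    · exact isCrestedWave_of_smooth hmM hMc hpos h.1 h.2.2.1 h.2.2.2.1.isGLB h.2.2.2.2 hcen
        (Or.inl h.2.2.2.1.1)
    · exact isCrestedWave_of_peaked hmM hpos h.1 h.2.2.2 h.2.2.1.isGLB hcen (Or.inl h.2.2.1.1)
    · exact isCrestedWave_of_cusped hmc hcM hpos h.1 h.2.2.2.1 h.2.2.2.2 h.2.2.1.isGLB hcen
        (Or.inl h.2.2.1.1)
  · have hpos := fun (hz : z < r) (hr : r ≤ m) y (hy : m < y) => cofactor_pos_of_real hrz hz hr hy
    rcases h with ⟨hz, hr, hmM, hMc, h⟩ | ⟨hz, hr, hmM, hMc, h⟩ | ⟨hz, hr, hmM, rfl, h⟩ |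
      ⟨hz, hr, hmM, rfl, h⟩ | ⟨hz, hr, hmc, hcM, h⟩ | ⟨hz, hr, hmc, hcM, h⟩
    · exact isCrestedWave_of_smooth hmM hMc (hpos hz hr.le) h.1 h.2.2.1 h.2.2.2.1.isGLB h.2.2.2.2
        hcen (Or.inl h.2.2.2.1.1)
    · exact isCrestedWave_of_smooth hmM hMc (hpos hz hr.le) h.1 h.2.1 h.2.2.1 h.2.2.2.1 hcen
        (Or.inr h.2.2.2.2.1)
    · exact isCrestedWave_of_peaked hmM (hpos hz hr.le) h.1 h.2.2.2 h.2.2.1.isGLB hcen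
        (Or.inl h.2.2.1.1)
    · exact isCrestedWave_of_peaked hmM (hpos hz hr.le) h.1 h.2.2.1 h.2.1 hcen
        (Or.inr h.2.2.2.1)
    · exact isCrestedWave_of_cusped hmc hcM (hpos hz hr.le) h.1 h.2.2.2.1 h.2.2.2.2 h.2.2.1.isGLB
        hcen (Or.inl h.2.2.1.1)
    · exact isCrestedWave_of_cusped hmc hcM (hpos hz hr.le) h.1 h.2.2.1 h.2.2.2.2.2 h.2.1 hcen
        (Or.inr h.2.2.2.1)
  · exact absurd h not_isKinkOf

/-! ### Continuous dependence away from the level $c$ -/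

/-- The reflection of a profile is a profile. -/
theorem IsProfile.comp_neg {m M c : ℝ} {φ : ℝ → ℝ} (h : IsProfile m M c φ) :
    IsProfile m M c fun ξ => φ (-ξ) where
  m_lt := h.m_lt
  cofactor_pos := h.cofactor_pos
  continuous := h.continuous.comp continuous_neg
  ge ξ := h.ge _
  le ξ := h.le _
  smooth := h.smooth.comp contDiff_neg.contDiffOn fun _ hξ => hξ
  deriv_sq ξ hξ := by rw [deriv_comp_neg, neg_sq]; exact h.deriv_sq _ hξ
  deriv_deriv ξ hξ := by
    have : deriv (fun ξ => φ (-ξ)) = fun ξ => - deriv φ (-ξ) := by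
      ext ξ; rw [deriv_comp_neg]
    rw [this, deriv.fun_neg, deriv_comp_neg, neg_neg]; exact h.deriv_deriv _ hξ
  isolated ξ hξ := by
    have h1 := h.isolated (-ξ) hξ
    have h2 : Tendsto (fun η : ℝ => -η) (𝓝[≠] ξ) (𝓝[≠] (-ξ)) :=
      tendsto_nhdsWithin_of_tendsto_nhds_of_eventually_within _
        ((continuous_neg.tendsto ξ).mono_left nhdsWithin_le_nhds)
        (eventually_mem_nhdsWithin.mono fun η hη => by simpa using hη)
    exact h2.eventually h1

theorem IsProfile.isOpen {m M c : ℝ} {φ : ℝ → ℝ} (h : IsProfile m M c φ) :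
    IsOpen {ξ | φ ξ ≠ c} := isOpen_ne h.continuous c

theorem IsProfile.hasDerivAt {m M c : ℝ} {φ : ℝ → ℝ} (h : IsProfile m M c φ) {ξ : ℝ}
    (hξ : φ ξ ≠ c) : HasDerivAt φ (deriv φ ξ) ξ :=
  hasDerivAt_of_contDiffOn h.isOpen h.smooth hξ

theorem IsProfile.hasDerivAt_deriv {m M c : ℝ} {φ : ℝ → ℝ} (h : IsProfile m M c φ) {ξ : ℝ}
    (hξ : φ ξ ≠ c) : HasDerivAt (deriv φ) (accel m M c (φ ξ)) ξ := by
  rw [← h.deriv_deriv ξ hξ]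
  exact hasDerivAt_of_contDiffOn h.isOpen (contDiffOn_deriv h.isOpen h.smooth) hξ

/-- `accel` as a function of the level and the parameters. -/
noncomputable def accelMap (q : ℝ × ℝ × ℝ × ℝ) : ℝ := accel q.2.1 q.2.2.1 q.2.2.2 q.1

theorem contDiffOn_accelMap : ContDiffOn ℝ 1 accelMap {q | q.1 < q.2.2.2} := by
  unfold accelMap accel speedSq cofactor linCoeff
  refine ContDiffOn.div ?_ (by fun_prop) fun q hq =>
    mul_ne_zero two_ne_zero (sub_ne_zero.2 (ne_of_gt hq))
  refine ((ContDiffOn.sub ?_ (by fun_prop)).add (by fun_prop)).add (by fun_prop)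
  exact ContDiffOn.div (by fun_prop) (by fun_prop) fun q hq => sub_ne_zero.2 (ne_of_gt hq)

/-- The vector field of the second order equation, with the parameters as constant components. -/
noncomputable def waveField (u : ℝ × ℝ × ℝ × ℝ × ℝ) : ℝ × ℝ × ℝ × ℝ × ℝ :=
  (accelMap u.2, u.1, 0, 0, 0)

/-- The state of a wave at a point. -/
noncomputable def waveState (m M c : ℝ) (φ : ℝ → ℝ) (t : ℝ) : ℝ × ℝ × ℝ × ℝ × ℝ :=
  (deriv φ t, φ t, m, M, c)

theorem IsProfile.hasDerivAt_waveState {m M c : ℝ} {φ : ℝ → ℝ} (h : IsProfile m M c φ) {ξ : ℝ}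
    (hξ : φ ξ ≠ c) : HasDerivAt (waveState m M c φ) (waveField (waveState m M c φ ξ)) ξ :=
  (h.hasDerivAt_deriv hξ).prodMk ((h.hasDerivAt hξ).prodMk
    ((hasDerivAt_const ξ m).prodMk ((hasDerivAt_const ξ M).prodMk (hasDerivAt_const ξ c))))

/-- Only the level and the parameters are confined to `K`. The slope enters the field linearly,
because $(\varphi')^2$ was eliminated from `accel`, so no a priori bound on slopes is needed. -/
theorem exists_lipschitzOnWith_waveField {K : Set (ℝ × ℝ × ℝ × ℝ)} (hK : IsCompact K)
    (hconv : Convex ℝ K) (hlt : K ⊆ {q | q.1 < q.2.2.2}) :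
    ∃ L, LipschitzOnWith L waveField {u | u.2 ∈ K} := by
  obtain ⟨L, hL⟩ := (contDiffOn_accelMap.mono hlt).exists_lipschitzOnWith one_ne_zero hconv hK
  have h1 : LipschitzOnWith (L * 1) (fun u : ℝ × ℝ × ℝ × ℝ × ℝ => accelMap u.2) {u | u.2 ∈ K} :=
    hL.comp LipschitzWith.prod_snd.lipschitzOnWith fun u hu => hu
  have h2 : LipschitzWith (max 1 0) (fun u : ℝ × ℝ × ℝ × ℝ × ℝ =>
      ((u.1, 0, 0, 0) : ℝ × ℝ × ℝ × ℝ)) :=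
    LipschitzWith.prod_fst.prodMk (LipschitzWith.const (0, 0, 0))
  exact ⟨_, h1.prodMk h2.lipschitzOnWith⟩

/-- Gronwall's inequality compares the states, with the parameters carried as constant components.
It needs the approximating waves to stay below their singular levels; a first exit argument secures
this. -/
theorem tendsto_of_tendsto_left {m M c : ℕ → ℝ} {m₀ M₀ c₀ : ℝ} {φ : ℕ → ℝ → ℝ} {φ₀ : ℝ → ℝ}
    (hφ : ∀ i, IsProfile (m i) (M i) (c i) (φ i)) (hφ₀ : IsProfile m₀ M₀ c₀ φ₀)
    (hm : Tendsto m atTop (𝓝 m₀)) (hM : Tendsto M atTop (𝓝 M₀)) (hc : Tendsto c atTop (𝓝 c₀))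
    {x y : ℝ} (hxy : x ≤ y) (hne : ∀ t ∈ Icc x y, φ₀ t ≠ c₀)
    (h0 : Tendsto (fun i => φ i x) atTop (𝓝 (φ₀ x)))
    (h1 : Tendsto (fun i => deriv (φ i) x) atTop (𝓝 (deriv φ₀ x))) :
    Tendsto (fun i => φ i y) atTop (𝓝 (φ₀ y)) ∧
      Tendsto (fun i => deriv (φ i) y) atTop (𝓝 (deriv φ₀ y)) := by
  obtain ⟨z, hz, hzmax⟩ := isCompact_Icc.exists_isMaxOn (nonempty_Icc.2 hxy)
    hφ₀.continuous.continuousOn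
  have hzc : φ₀ z < c₀ := lt_of_le_of_ne ((hφ₀.le z).trans (min_le_right _ _)) (hne z hz)
  -- The margins: $\varphi_0\le c_0-4\delta$ on the interval, the box `K` allows levels up to
  -- $c_0-\delta$, and eventually $c_i>c_0-\delta/2$. An error below $\delta$ thus keeps $\varphi_i$
  -- strictly inside.
  obtain ⟨δ, hδ, hδz⟩ : ∃ δ, 0 < δ ∧ φ₀ z = c₀ - 4 * δ := ⟨(c₀ - φ₀ z) / 4, by linarith, by ring⟩
  have hle0 : ∀ t ∈ Icc x y, φ₀ t ≤ c₀ - 4 * δ := fun t ht => hδz ▸ hzmax ht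
  set K : Set (ℝ × ℝ × ℝ × ℝ) :=
    Icc (m₀ - 1, m₀ - 1, M₀ - 1, c₀ - δ / 2) (c₀ - δ, m₀ + 1, M₀ + 1, c₀ + 1) with hK
  have hKlt : K ⊆ {q | q.1 < q.2.2.2} := by
    rintro ⟨q1, q2, q3, q4⟩ ⟨⟨-, -, -, ha⟩, ⟨hb, -⟩⟩
    simp only [mem_ofPred_eq] at *
    linarith
  obtain ⟨L, hL⟩ := exists_lipschitzOnWith_waveField isCompact_Icc (convex_Icc _ _) hKlt
  set u : ℕ → ℝ → _ := fun i => waveState (m i) (M i) (c i) (φ i) with hu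
  set u₀ := waveState m₀ M₀ c₀ φ₀ with hu₀
  have hux : Tendsto (fun i => u i x) atTop (𝓝 (u₀ x)) :=
    h1.prodMk_nhds (h0.prodMk_nhds (hm.prodMk_nhds (hM.prodMk_nhds hc)))
  have hdist : Tendsto (fun i => dist (u i x) (u₀ x) * Real.exp (L * (y - x))) atTop (𝓝 0) := by
    simpa using (tendsto_iff_dist_tendsto_zero.1 hux).mul_const (Real.exp (L * (y - x)))
  have hmem0 : ∀ t ∈ Icc x y, (u₀ t).2 ∈ K := by
    intro t ht
    have := hle0 t ht
    have := hφ₀.ge t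
    refine ⟨⟨?_, ?_, ?_, ?_⟩, ⟨?_, ?_, ?_, ?_⟩⟩ <;> simp only [hu₀, waveState] <;> linarith
  have hd : ∀ i t, dist (φ i t) (φ₀ t) ≤ dist (u i t) (u₀ t) := fun i t =>
    (le_max_left _ _).trans (le_max_right _ _)
  have key : ∀ᶠ i in atTop,
      dist (u i y) (u₀ y) ≤ dist (u i x) (u₀ x) * Real.exp (L * (y - x)) := by
    filter_upwards [hdist.eventually_lt_const hδ, hm.eventually (Ioo_mem_nhds (sub_one_lt m₀)
      (lt_add_one m₀)), hM.eventually (Ioo_mem_nhds (sub_one_lt M₀) (lt_add_one M₀)),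
      hc.eventually (Ioo_mem_nhds (show c₀ - δ / 2 < c₀ by linarith) (lt_add_one c₀))]
      with i hi1 hi2 hi3 hi4
    have hne' : ∀ t, φ i t ≤ c₀ - δ → φ i t ≠ c i := fun t ht =>
      (show φ i t < c i by linarith [hi4.1]).ne
    have hgron : ∀ s ∈ Icc x y, (∀ t ∈ Ico x s, φ i t ≤ c₀ - δ) → φ i s ≤ c₀ - δ →
        dist (u i s) (u₀ s) ≤ dist (u i x) (u₀ x) * Real.exp (L * (y - x)) := by
      intro s hs hlt hle
      have hlt' : ∀ t ∈ Icc x s, φ i t ≤ c₀ - δ := fun t ht =>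
        ht.2.lt_or_eq.elim (fun h => hlt t ⟨ht.1, h⟩) fun h => h ▸ hle
      have hder : ∀ t ∈ Icc x s, HasDerivAt (u i) (waveField (u i t)) t := fun t ht =>
        (hφ i).hasDerivAt_waveState (hne' t (hlt' t ht))
      have hder0 : ∀ t ∈ Icc x s, HasDerivAt u₀ (waveField (u₀ t)) t := fun t ht =>
        hφ₀.hasDerivAt_waveState (hne t ⟨ht.1, ht.2.trans hs.2⟩)
      have := dist_le_of_trajectories_ODE_of_mem (v := fun _ => waveField)
        (s := fun _ => {u | u.2 ∈ K}) (K := L) (a := x) (b := s) (f := u i) (g := u₀)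
        (fun _ _ => hL) (fun t ht => (hder t ht).continuousAt.continuousWithinAt)
        (fun t ht => (hder t (Ico_subset_Icc_self ht)).hasDerivWithinAt)
        (fun t ht => by
          have h5 := hlt t ht
          have h6 := (hφ i).ge t
          have := hi2.1; have := hi2.2; have := hi3.1; have := hi3.2
          have := hi4.1; have := hi4.2
          refine ⟨⟨?_, ?_, ?_, ?_⟩, ⟨?_, ?_, ?_, ?_⟩⟩ <;> simp only [hu, waveState] <;> linarith)
        (fun t ht => (hder0 t ht).continuousAt.continuousWithinAt)
        (fun t ht => (hder0 t (Ico_subset_Icc_self ht)).hasDerivWithinAt)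
        (fun t ht => hmem0 t ⟨ht.1, ht.2.le.trans hs.2⟩) le_rfl s (right_mem_Icc.2 hs.1)
      refine this.trans (mul_le_mul_of_nonneg_left (Real.exp_le_exp.2 ?_) dist_nonneg)
      exact mul_le_mul_of_nonneg_left (by linarith [hs.2]) L.coe_nonneg
    have hstay : ∀ t ∈ Icc x y, φ i t < c₀ - δ := by
      by_contra! hcon
      obtain ⟨t₀, ht₀, ht₀'⟩ := hcon
      -- At the first time `s` when $\varphi_i\ge c_0-\delta$, the estimate still holds on $[x,s]$
      -- and gives $\varphi_i(s)<c_0-\delta$, a contradiction.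
      set Z : Set ℝ := Icc x y ∩ {t | c₀ - δ ≤ φ i t} with hZ
      have hZc : IsCompact Z :=
        isCompact_Icc.inter_right (isClosed_le continuous_const (hφ i).continuous)
      obtain ⟨s, ⟨hs, hsδ⟩, hsmin⟩ := hZc.exists_isLeast ⟨t₀, ht₀, ht₀'⟩
      have hbefore : ∀ t ∈ Ico x s, φ i t ≤ c₀ - δ := by
        intro t ht
        by_contra! hcon
        exact absurd (hsmin ⟨⟨ht.1, ht.2.le.trans hs.2⟩, hcon.le⟩) (not_le.2 ht.2)
      have hfin : ∀ s' ∈ Icc x y, φ₀ s' ≤ c₀ - 4 * δ →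
          dist (u i s') (u₀ s') ≤ dist (u i x) (u₀ x) * Real.exp (L * (y - x)) →
          φ i s' < c₀ - δ := by
        intro s' _ h2 h3
        have := ((hd i s').trans h3).trans_lt hi1
        rw [Real.dist_eq] at this
        linarith [(abs_lt.1 this).2]
      have hxs : x < s := by
        refine lt_of_le_of_ne hs.1 fun hxs => ?_
        have h4 := hfin x (left_mem_Icc.2 hxy) (hle0 x (left_mem_Icc.2 hxy))
          (le_mul_of_one_le_right dist_nonneg (Real.one_le_exp
            (mul_nonneg L.coe_nonneg (sub_nonneg.2 hxy))))
        rw [hxs] at h4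
        exact absurd hsδ (not_le.2 h4)
      have hsle : φ i s ≤ c₀ - δ := by
        refine le_of_tendsto (((hφ i).continuous.tendsto s).mono_left
          (nhdsWithin_le_nhds (s := Iio s))) ?_
        filter_upwards [Ioo_mem_nhdsLT hxs] with t ht using hbefore t ⟨ht.1.le, ht.2⟩
      exact absurd hsδ (not_le.2 (hfin s hs (hle0 s hs) (hgron s hs hbefore hsle)))
    exact hgron y (right_mem_Icc.2 hxy) (fun t ht => (hstay t (Ico_subset_Icc_self ht)).le)
      (hstay y (right_mem_Icc.2 hxy)).le
  have huy : Tendsto (fun i => u i y) atTop (𝓝 (u₀ y)) :=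
    tendsto_iff_dist_tendsto_zero.2
      (squeeze_zero' (Eventually.of_forall fun _ => dist_nonneg) key hdist)
  exact ⟨((continuous_fst.comp continuous_snd).tendsto _).comp huy,
    (continuous_fst.tendsto _).comp huy⟩

/-- Convergence of `(φ, φ')` propagates along intervals without crests of the limit. -/
theorem tendsto_of_tendsto_uIcc {m M c : ℕ → ℝ} {m₀ M₀ c₀ : ℝ} {φ : ℕ → ℝ → ℝ} {φ₀ : ℝ → ℝ}
    (hφ : ∀ i, IsProfile (m i) (M i) (c i) (φ i)) (hφ₀ : IsProfile m₀ M₀ c₀ φ₀)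
    (hm : Tendsto m atTop (𝓝 m₀)) (hM : Tendsto M atTop (𝓝 M₀)) (hc : Tendsto c atTop (𝓝 c₀))
    {x y : ℝ} (hne : ∀ t ∈ uIcc x y, φ₀ t ≠ c₀)
    (h0 : Tendsto (fun i => φ i x) atTop (𝓝 (φ₀ x)))
    (h1 : Tendsto (fun i => deriv (φ i) x) atTop (𝓝 (deriv φ₀ x))) :
    Tendsto (fun i => φ i y) atTop (𝓝 (φ₀ y)) ∧
      Tendsto (fun i => deriv (φ i) y) atTop (𝓝 (deriv φ₀ y)) := by
  rcases le_total x y with hxy | hxy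
  · rw [uIcc_of_le hxy] at hne
    exact tendsto_of_tendsto_left hφ hφ₀ hm hM hc hxy hne h0 h1
  · rw [uIcc_of_ge hxy] at hne
    have := tendsto_of_tendsto_left (fun i => (hφ i).comp_neg) hφ₀.comp_neg hm hM hc
      (neg_le_neg hxy) (fun t ht => hne (-t) ⟨by linarith [ht.2], by linarith [ht.1]⟩)
      (by simpa using h0) (by simp only [deriv_comp_neg, neg_neg]; exact h1.neg)
    simp only [deriv_comp_neg, neg_neg] at this
    exact ⟨this.1, by simpa using this.2.neg⟩

/-! ### The clock: time as a function of depth below the top -/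

/-- The time a wave needs per unit of depth, at depth `s` below its top level. -/
noncomputable def clockRate (m M c s : ℝ) : ℝ := (√(speedSq m M c (min M c - s)))⁻¹

/-- The time a wave needs between its top level and the depth `t` below it. -/
noncomputable def clock (m M c t : ℝ) : ℝ := ∫ s in (0)..t, clockRate m M c s

theorem clock_zero (m M c : ℝ) : clock m M c 0 = 0 := intervalIntegral.integral_same

theorem measurable_clockRate (m M c : ℝ) : Measurable (clockRate m M c) := by
  unfold clockRate speedSq cofactor; fun_prop

/-- The linear lower bound holds in both regimes. If the top is $M$, then $M-y=s$ and $c-y\le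
A+\rho$; if it is $c$, then $c-y=s\le M-y$. Its constant depends only on `κ`, `A`, `ρ`, so it is
uniform along a convergent sequence of parameters. -/
theorem speedSq_ge {m M c κ A ρ s : ℝ} (hκ : 0 < κ) (hs : 0 < s) (hsρ : s ≤ ρ)
    (hA : c - min M c ≤ A) (hG : κ ≤ cofactor m M c (min M c - s)) :
    κ / (A + ρ) * s ≤ speedSq m M c (min M c - s) := by
  have hA0 : 0 ≤ A := (sub_nonneg.2 (min_le_right M c)).trans hA
  have h1 : 0 < c - (min M c - s) := by linarith [min_le_right M c]
  have h2 : 0 < M - (min M c - s) := by linarith [min_le_left M c]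
  rw [speedSq, le_div_iff₀ h1, div_mul_eq_mul_div, div_mul_eq_mul_div,
    div_le_iff₀ (by linarith : 0 < A + ρ)]
  have h3 : s * (c - (min M c - s)) ≤ (M - (min M c - s)) * (A + ρ) := by
    rcases min_choice M c with h | h
    · rw [h] at hA ⊢
      rw [sub_sub_cancel]
      exact mul_le_mul_of_nonneg_left (by linarith) hs.le
    · have hcM := min_eq_right_iff.1 h
      rw [h, sub_sub_cancel]
      exact mul_le_mul (by linarith) (by linarith) hs.le (by linarith)
  calc κ * s * (c - (min M c - s)) = κ * (s * (c - (min M c - s))) := by ring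
    _ ≤ κ * ((M - (min M c - s)) * (A + ρ)) := mul_le_mul_of_nonneg_left h3 hκ.le
    _ ≤ cofactor m M c (min M c - s) * ((M - (min M c - s)) * (A + ρ)) :=
        mul_le_mul_of_nonneg_right hG (mul_nonneg h2.le (by linarith))
    _ = _ := by ring

/-- This is the integrable majorant used for dominated convergence of the clocks. -/
theorem clockRate_le {m M c κ A ρ s : ℝ} (hκ : 0 < κ) (hs : 0 < s) (hsρ : s ≤ ρ)
    (hA : c - min M c ≤ A) (hG : κ ≤ cofactor m M c (min M c - s)) :
    clockRate m M c s ≤ (√(κ / (A + ρ)))⁻¹ * s ^ (-(1 / 2) : ℝ) := by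
  have hA0 : 0 ≤ A := (sub_nonneg.2 (min_le_right M c)).trans hA
  have hpos : 0 < κ / (A + ρ) := div_pos hκ (by linarith)
  rw [Real.rpow_neg hs.le, ← Real.sqrt_eq_rpow, ← mul_inv, ← Real.sqrt_mul hpos.le]
  exact inv_anti₀ (Real.sqrt_pos.2 (mul_pos hpos hs))
    (Real.sqrt_le_sqrt (speedSq_ge hκ hs hsρ hA hG))

theorem intervalIntegrable_rpow_neg_half (C a b : ℝ) :
    IntervalIntegrable (fun s : ℝ => C * s ^ (-(1 / 2) : ℝ)) volume a b :=
  (intervalIntegral.intervalIntegrable_rpow' (by norm_num)).const_mul C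

section
variable {m M c : ℝ} {φ : ℝ → ℝ}

theorem IsProfile.speedSq_pos (h : IsProfile m M c φ) {y : ℝ} (h1 : m < y) (h2 : y < min M c) :
    0 < speedSq m M c y :=
  div_pos (mul_pos (sub_pos.2 (h2.trans_le (min_le_left _ _))) (h.cofactor_pos y h1 h2.le))
    (sub_pos.2 (h2.trans_le (min_le_right _ _)))

theorem continuousAt_speedSq {y : ℝ} (hy : y ≠ c) : ContinuousAt (speedSq m M c) y := by
  unfold speedSq cofactor
  exact ContinuousAt.div (by fun_prop) (by fun_prop) (sub_ne_zero.2 hy.symm)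

theorem IsProfile.clockRate_pos (h : IsProfile m M c φ) {s : ℝ} (h1 : 0 < s)
    (h2 : s < min M c - m) : 0 < clockRate m M c s :=
  inv_pos.2 (Real.sqrt_pos.2 (h.speedSq_pos (by linarith) (by linarith)))

theorem IsProfile.continuousAt_clockRate (h : IsProfile m M c φ) {s : ℝ} (h1 : 0 < s)
    (h2 : s < min M c - m) : ContinuousAt (clockRate m M c) s := by
  have hF : ContinuousAt (fun s => speedSq m M c (min M c - s)) s :=
    ContinuousAt.comp (f := fun s => min M c - s) (x := s)
      (continuousAt_speedSq (by linarith [min_le_right M c] : min M c - s < c).ne) (by fun_prop)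
  exact (Real.continuous_sqrt.continuousAt.comp hF).inv₀
    (Real.sqrt_pos.2 (h.speedSq_pos (by linarith) (by linarith))).ne'

theorem continuous_cofactor : Continuous (cofactor m M c) := by
  unfold cofactor; fun_prop

theorem IsProfile.intervalIntegrable_clockRate (h : IsProfile m M c φ) {t : ℝ} (h1 : 0 ≤ t)
    (h2 : t < min M c - m) : IntervalIntegrable (clockRate m M c) volume 0 t := by
  obtain ⟨s₀, hs₀, hmin⟩ := isCompact_Icc.exists_isMinOn (nonempty_Icc.2 h1)
    (f := fun s => cofactor m M c (min M c - s))
    (continuous_cofactor.comp (continuous_const.sub continuous_id)).continuousOn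
  have hκ : 0 < cofactor m M c (min M c - s₀) :=
    h.cofactor_pos _ (by linarith [hs₀.2]) (by linarith [hs₀.1])
  refine (intervalIntegrable_rpow_neg_half
    (√(cofactor m M c (min M c - s₀) / (c - min M c + t)))⁻¹ 0 t).mono_fun
    (measurable_clockRate m M c).aestronglyMeasurable ?_
  rw [uIoc_of_le h1]
  refine (ae_restrict_iff' measurableSet_Ioc).2 (Eventually.of_forall fun s hs => ?_)
  have h0 : 0 ≤ clockRate m M c s := inv_nonneg.2 (Real.sqrt_nonneg _)
  simp only [Real.norm_of_nonneg h0]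
  exact (clockRate_le hκ hs.1 hs.2 le_rfl (hmin ⟨hs.1.le, hs.2⟩)).trans (le_abs_self _)

theorem IsProfile.hasDerivAt_clock (h : IsProfile m M c φ) {t : ℝ} (h1 : 0 < t)
    (h2 : t < min M c - m) : HasDerivAt (clock m M c) (clockRate m M c t) t :=
  intervalIntegral.integral_hasDerivAt_right (h.intervalIntegrable_clockRate h1.le h2)
    (measurable_clockRate m M c).stronglyMeasurable.stronglyMeasurableAtFilter
    (h.continuousAt_clockRate h1 h2)

theorem IsProfile.continuousOn_clock (h : IsProfile m M c φ) {ρ : ℝ} (h1 : 0 ≤ ρ)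
    (h2 : ρ < min M c - m) : ContinuousOn (clock m M c) (Icc 0 ρ) := by
  have := intervalIntegral.continuousOn_primitive_interval
    ((intervalIntegrable_iff' (by finiteness)).1 (h.intervalIntegrable_clockRate h1 h2))
  rwa [uIcc_of_le h1] at this

theorem IsProfile.strictMonoOn_clock (h : IsProfile m M c φ) {ρ : ℝ} (h1 : 0 ≤ ρ)
    (h2 : ρ < min M c - m) : StrictMonoOn (clock m M c) (Icc 0 ρ) := by
  refine strictMonoOn_of_deriv_pos (convex_Icc _ _) (h.continuousOn_clock h1 h2) fun t ht => ?_
  rw [interior_Icc] at ht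
  rw [(h.hasDerivAt_clock ht.1 (ht.2.trans h2)).deriv]
  exact h.clockRate_pos ht.1 (ht.2.trans h2)

theorem IsProfile.deriv_ne_zero (h : IsProfile m M c φ) {ξ : ℝ} (h1 : m < φ ξ)
    (h2 : φ ξ < min M c) : deriv φ ξ ≠ 0 := by
  have := h.deriv_sq ξ (h2.trans_le (min_le_right _ _)).ne
  intro h0
  rw [h0] at this
  have h3 := h.speedSq_pos h1 h2
  rw [← this] at h3
  simp at h3

/-- The sign `σ` is $1$ where the wave descends and $-1$ where it rises, and
$-\varphi'/|\varphi'|=\sigma$. -/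
theorem IsProfile.hasDerivAt_clock_comp (h : IsProfile m M c φ) {ξ σ : ℝ} (hσ : σ ^ 2 = 1)
    (h1 : m < φ ξ) (h2 : φ ξ < min M c) (h3 : 0 < -(σ * deriv φ ξ)) :
    HasDerivAt (fun η => clock m M c (min M c - φ η)) σ ξ := by
  have hne : φ ξ ≠ c := (h2.trans_le (min_le_right _ _)).ne
  have hd : HasDerivAt (fun η => clock m M c (min M c - φ η))
      (clockRate m M c (min M c - φ ξ) * -deriv φ ξ) ξ :=
    HasDerivAt.comp (h₂ := clock m M c) (h := fun η => min M c - φ η) ξ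
      (h.hasDerivAt_clock (by linarith) (by linarith)) ((h.hasDerivAt hne).const_sub (min M c))
  convert hd using 1
  have hsq : √(speedSq m M c (φ ξ)) = -(σ * deriv φ ξ) := by
    rw [← h.deriv_sq ξ hne, show deriv φ ξ ^ 2 = (-(σ * deriv φ ξ)) ^ 2 by
      rw [neg_sq, mul_pow, hσ, one_mul], Real.sqrt_sq h3.le]
  rw [clockRate, sub_sub_cancel, hsq, eq_inv_mul_iff_mul_eq₀ h3.ne']
  linear_combination (-deriv φ ξ) * hσ

/-- Along a branch between the top level and the depth `ρ` below it, `clock` measures time. -/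
theorem IsProfile.branch (h : IsProfile m M c φ) {ρ η σ : ℝ} (hρ : ρ < min M c - m)
    (hσ : σ ^ 2 = 1) (h1 : φ η < min M c) (h2 : min M c - ρ < φ η) (h3 : 0 < -(σ * deriv φ η)) :
    ∀ ξ, 0 < clock m M c (min M c - φ η) + σ * (ξ - η) →
      clock m M c (min M c - φ η) + σ * (ξ - η) < clock m M c ρ →
      φ ξ < min M c ∧ min M c - ρ < φ ξ ∧ 0 < -(σ * deriv φ ξ) ∧
        clock m M c (min M c - φ ξ) = clock m M c (min M c - φ η) + σ * (ξ - η) := by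
  have hρ0 : 0 < ρ := by linarith
  set a := clock m M c (min M c - φ η) with ha
  -- `J` consists of the points where the predicted clock value stays between the top and depth `ρ`;
  -- `u` is shown relatively open and closed in it.
  set J : Set ℝ := {ξ | 0 < a + σ * (ξ - η) ∧ a + σ * (ξ - η) < clock m M c ρ} with hJ
  have hmono := h.strictMonoOn_clock hρ0.le hρ
  have h0ρ : (0 : ℝ) ∈ Icc 0 ρ := left_mem_Icc.2 hρ0.le
  have hρρ : ρ ∈ Icc 0 ρ := right_mem_Icc.2 hρ0.le
  have hJc : IsPreconnected J := by
    have : J = (fun s => η + σ * (s - a)) '' Ioo 0 (clock m M c ρ) := by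
      ext ξ
      constructor
      · intro hξ
        refine ⟨a + σ * (ξ - η), hξ, ?_⟩
        simp only
        linear_combination (ξ - η) * hσ
      · rintro ⟨s, hs, rfl⟩
        have : a + σ * (η + σ * (s - a) - η) = s := by linear_combination (s - a) * hσ
        exact ⟨by rw [this]; exact hs.1, by rw [this]; exact hs.2⟩
    rw [this]
    exact isPreconnected_Ioo.image _ (by fun_prop)
  set u : Set ℝ := {ξ | φ ξ < min M c ∧ min M c - ρ < φ ξ ∧ 0 < -(σ * deriv φ ξ) ∧
        clock m M c (min M c - φ ξ) = a + σ * (ξ - η)} with hu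
  have hcd : ∀ ξ, φ ξ < min M c → ContinuousAt (deriv φ) ξ := fun ξ hξ =>
    (h.hasDerivAt_deriv (hξ.trans_le (min_le_right _ _)).ne).continuousAt
  have hopen : IsOpen u := by
    rw [isOpen_iff_mem_nhds]
    rintro ξ ⟨e1, e2, e3, e4⟩
    have hev : ∀ᶠ z in 𝓝 ξ, φ z < min M c ∧ min M c - ρ < φ z ∧ 0 < -(σ * deriv φ z) :=
      (h.continuous.continuousAt.eventually_lt_const e1).and
        ((h.continuous.continuousAt.eventually_const_lt e2).and
          (((hcd ξ e1).const_mul σ).neg.eventually_const_lt e3))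
    obtain ⟨l, r, hlr, hsub⟩ := mem_nhds_iff_exists_Ioo_subset.1 hev
    filter_upwards [Ioo_mem_nhds hlr.1 hlr.2] with z hz
    obtain ⟨f1, f2, f3⟩ := hsub hz
    refine ⟨f1, f2, f3, ?_⟩
    have hder : ∀ x ∈ Ioo l r,
        HasDerivAt (fun x => clock m M c (min M c - φ x) - σ * x) (σ - σ * 1) x := fun x hx =>
      (h.hasDerivAt_clock_comp hσ (by linarith [(hsub hx).2.1]) (hsub hx).1 (hsub hx).2.2).sub
        ((hasDerivAt_id x).const_mul σ)
    have := isOpen_Ioo.is_const_of_deriv_eq_zero isPreconnected_Ioo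
      (fun x hx => (hder x hx).differentiableAt.differentiableWithinAt)
      (fun x hx => by rw [(hder x hx).deriv]; simp) hz hlr
    linear_combination this + e4
  have hcl : closure u ∩ J ⊆ u := by
    rintro ξ ⟨hξ, hξJ⟩
    obtain ⟨x, hx, hxlim⟩ := mem_closure_iff_seq_limit.1 hξ
    have hφx := (h.continuous.tendsto ξ).comp hxlim
    have hmem : min M c - φ ξ ∈ Icc 0 ρ :=
      ⟨sub_nonneg.2 (h.le ξ), by
        have := ge_of_tendsto' hφx fun n => (hx n).2.1.le
        linarith⟩
    -- The clock identity survives the limit, and strict monotonicity of the clock turns the strict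
    -- bounds defining `J` back into strict bounds on the level. The sign of the slope persists
    -- because the slope cannot vanish strictly between the levels.
    have hXw : clock m M c (min M c - φ ξ) = a + σ * (ξ - η) := by
      have t1 : Tendsto (fun n => clock m M c (min M c - φ (x n))) atTop
          (𝓝 (clock m M c (min M c - φ ξ))) := by
        refine (h.continuousOn_clock hρ0.le hρ _ hmem).tendsto.comp ?_
        exact tendsto_nhdsWithin_iff.2 ⟨tendsto_const_nhds.sub hφx, Eventually.of_forall fun n =>
          ⟨sub_nonneg.2 (h.le _), by linarith [(hx n).2.1]⟩⟩
      have t2 : Tendsto (fun n => a + σ * (x n - η)) atTop (𝓝 (a + σ * (ξ - η))) :=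
        ((hxlim.sub_const η).const_mul σ).const_add a
      exact tendsto_nhds_unique (t1.congr fun n => (hx n).2.2.2) t2
    have g1 : φ ξ < min M c := by
      have : (0 : ℝ) < min M c - φ ξ :=
        (hmono.lt_iff_lt h0ρ hmem).1 (by rw [clock_zero, hXw]; exact hξJ.1)
      linarith
    have g2 : min M c - ρ < φ ξ := by
      have : min M c - φ ξ < ρ :=
        (hmono.lt_iff_lt hmem hρρ).1 (by rw [hXw]; exact hξJ.2)
      linarith
    refine ⟨g1, g2, lt_of_le_of_ne ?_ ?_, hXw⟩
    · exact ge_of_tendsto' ((((hcd ξ g1).const_mul σ).neg.tendsto).comp hxlim)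
        fun n => (hx n).2.2.1.le
    · have hσ0 : σ ≠ 0 := by rintro rfl; norm_num at hσ
      exact (neg_ne_zero.2 (mul_ne_zero hσ0 (h.deriv_ne_zero (by linarith) g1))).symm
  have hηu : η ∈ u := ⟨h1, h2, h3, by rw [sub_self, mul_zero, add_zero]⟩
  have hηJ : η ∈ J := by
    have hmem : min M c - φ η ∈ Icc 0 ρ := ⟨by linarith, by linarith⟩
    refine ⟨?_, ?_⟩ <;> rw [sub_self, mul_zero, add_zero]
    · have := hmono h0ρ hmem (by linarith)
      rwa [clock_zero] at this
    · exact hmono hmem hρρ (by linarith)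
  intro ξ g1 g2
  exact hJc.subset_of_closure_inter_subset hopen ⟨η, hηJ, hηu⟩ hcl ⟨g1, g2⟩

/-- A branch leads back to the top level. -/
theorem IsProfile.branch_end (h : IsProfile m M c φ) {ρ η σ : ℝ} (hρ : ρ < min M c - m)
    (hσ : σ ^ 2 = 1) (h1 : φ η < min M c) (h2 : min M c - ρ < φ η) (h3 : 0 < -(σ * deriv φ η)) :
    φ (η - σ * clock m M c (min M c - φ η)) = min M c := by
  have hρ0 : 0 < ρ := by linarith
  have hb := h.branch hρ hσ h1 h2 h3
  set a := clock m M c (min M c - φ η) with ha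
  set x := η - σ * a with hx
  have hmono := h.strictMonoOn_clock hρ0.le hρ
  have h0ρ : (0 : ℝ) ∈ Icc 0 ρ := left_mem_Icc.2 hρ0.le
  have hXρ : 0 < clock m M c ρ := by
    have := hmono h0ρ (right_mem_Icc.2 hρ0.le) hρ0
    rwa [clock_zero] at this
  have hpath : Tendsto (fun s => x + σ * s) (𝓝[>] 0) (𝓝 x) := by
    have : Tendsto (fun s => x + σ * s) (𝓝 0) (𝓝 (x + σ * 0)) :=
      Continuous.tendsto (by fun_prop) 0
    rw [mul_zero, add_zero] at this
    exact this.mono_left nhdsWithin_le_nhds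
  have hev : ∀ᶠ s in 𝓝[>] 0, min M c - ρ < φ (x + σ * s) ∧
      clock m M c (min M c - φ (x + σ * s)) = s := by
    filter_upwards [Ioo_mem_nhdsGT hXρ] with s hs
    have hs' : a + σ * (x + σ * s - η) = s := by rw [hx]; linear_combination (s - a) * hσ
    have := hb (x + σ * s) (by rw [hs']; exact hs.1) (by rw [hs']; exact hs.2)
    rw [hs'] at this
    exact ⟨this.2.1, this.2.2.2⟩
  have hφx := (h.continuous.tendsto x).comp hpath
  have hmem : min M c - φ x ∈ Icc 0 ρ :=
    ⟨sub_nonneg.2 (h.le x), by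
      have := ge_of_tendsto hφx (hev.mono fun s hs => hs.1.le)
      linarith⟩
  have t1 : Tendsto (fun s => clock m M c (min M c - φ (x + σ * s))) (𝓝[>] 0)
      (𝓝 (clock m M c (min M c - φ x))) := by
    refine (h.continuousOn_clock hρ0.le hρ _ hmem).tendsto.comp ?_
    exact tendsto_nhdsWithin_iff.2 ⟨tendsto_const_nhds.sub hφx, hev.mono fun s hs =>
      ⟨sub_nonneg.2 (h.le _), by linarith [hs.1]⟩⟩
  have h0 : clock m M c (min M c - φ x) = 0 :=
    tendsto_nhds_unique (t1.congr' (hev.mono fun s hs => hs.2))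
      (tendsto_id.mono_left nhdsWithin_le_nhds)
  have := hmono.injOn hmem h0ρ (by rw [h0, clock_zero])
  linarith

/-- Isolation of the top gives points just to its right with $\varphi'<0$. The branch through such a
point can be followed down to depth `ρ`, and up to a top, which has to be `x`. -/
theorem IsProfile.descent_right (h : IsProfile m M c φ) {ρ x : ℝ} (hρ0 : 0 < ρ)
    (hρ : ρ < min M c - m) (hx : φ x = min M c) :
    ∀ ξ, 0 < ξ - x → ξ - x < clock m M c ρ →
      φ ξ < min M c ∧ min M c - ρ < φ ξ ∧ deriv φ ξ < 0 ∧
        clock m M c (min M c - φ ξ) = ξ - x := by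
  have hev : ∀ᶠ z in 𝓝[>] x, φ z < min M c ∧ min M c - ρ < φ z := by
    have e1 := (h.isolated x hx).filter_mono (nhdsWithin_mono x fun y hy => ne_of_gt hy)
    have e2 : ∀ᶠ z in 𝓝 x, min M c - ρ < φ z :=
      h.continuous.continuousAt.eventually_const_lt (by rw [hx]; linarith)
    filter_upwards [e1, e2.filter_mono nhdsWithin_le_nhds] with z hz1 hz2
    exact ⟨lt_of_le_of_ne (h.le z) hz1, hz2⟩
  obtain ⟨r, hr, hsub⟩ := mem_nhdsGT_iff_exists_Ioo_subset.1 hev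
  have hxr : x < r := hr
  obtain ⟨z, hz⟩ := exists_between hxr
  obtain ⟨η, hη, hη'⟩ := exists_deriv_eq_slope φ hz.1 h.continuous.continuousOn
    fun y hy => (h.hasDerivAt ((hsub ⟨hy.1, hy.2.trans hz.2⟩).1.trans_le
      (min_le_right _ _)).ne).differentiableAt.differentiableWithinAt
  have hηmem := hsub (show η ∈ Ioo x r from ⟨hη.1, hη.2.trans hz.2⟩)
  have hd : deriv φ η < 0 := by
    rw [hη', hx]
    exact div_neg_of_neg_of_pos (sub_neg.2 (hsub hz).1) (sub_pos.2 hz.1)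
  have hσ : (1 : ℝ) ^ 2 = 1 := one_pow 2
  have h3 : 0 < -(1 * deriv φ η) := by linarith
  have hb := h.branch hρ hσ hηmem.1 hηmem.2 h3
  have he := h.branch_end hρ hσ hηmem.1 hηmem.2 h3
  set a := clock m M c (min M c - φ η) with ha
  have hmono := h.strictMonoOn_clock hρ0.le hρ
  have hmem : min M c - φ η ∈ Icc 0 ρ := ⟨by linarith [hηmem.1], by linarith [hηmem.2]⟩
  have ha0 : 0 < a := by
    have := hmono (left_mem_Icc.2 hρ0.le) hmem (by linarith [hηmem.1])
    rwa [clock_zero] at this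
  have haρ : a < clock m M c ρ :=
    hmono hmem (right_mem_Icc.2 hρ0.le) (by linarith [hηmem.2])
  rw [one_mul] at he
  -- If the branch began before `x`, it would pass `x` strictly below the top level; if it began
  -- after `x`, there would be a top in `(x, r)`.
  have hxa : η - a = x := by
    rcases lt_trichotomy (η - a) x with hlt | heq | hgt
    · have := (hb x (by linarith) (by linarith [hη.1])).1
      exact absurd hx this.ne
    · exact heq
    · have := (hsub (show η - a ∈ Ioo x r from ⟨hgt, by linarith [hη.2, hz.2]⟩)).1
      exact absurd he this.ne
  intro ξ g1 g2
  have e : a + 1 * (ξ - η) = ξ - x := by linarith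
  have := hb ξ (by rw [e]; exact g1) (by rw [e]; exact g2)
  rw [e] at this
  exact ⟨this.1, this.2.1, by linarith [this.2.2.1], this.2.2.2⟩

/-- The shape of a wave near a top. -/
theorem IsProfile.descent (h : IsProfile m M c φ) {ρ x σ : ℝ} (hρ0 : 0 < ρ)
    (hρ : ρ < min M c - m) (hx : φ x = min M c) (hσ : σ = 1 ∨ σ = -1) :
    ∀ ξ, 0 < σ * (ξ - x) → σ * (ξ - x) < clock m M c ρ →
      φ ξ < min M c ∧ min M c - ρ < φ ξ ∧ 0 < -(σ * deriv φ ξ) ∧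
        clock m M c (min M c - φ ξ) = σ * (ξ - x) := by
  intro ξ g1 g2
  rcases hσ with rfl | rfl
  · simp only [one_mul] at *
    obtain ⟨e1, e2, e3, e4⟩ := h.descent_right hρ0 hρ hx ξ g1 g2
    exact ⟨e1, e2, by linarith, e4⟩
  · have e : -ξ - -x = -1 * (ξ - x) := by ring
    have := h.comp_neg.descent_right (x := -x) hρ0 hρ (by simpa using hx) (-ξ)
      (by rw [e]; exact g1) (by rw [e]; exact g2)
    simp only [deriv_comp_neg, neg_neg, e] at this
    obtain ⟨e1, e2, e3, e4⟩ := this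
    exact ⟨e1, e2, by linarith, e4⟩

end

/-! ### Convergence of clocks and of tops -/

/-- Profiles whose parameters converge to those of a profile. -/
structure ConvergentProfiles (m M c : ℕ → ℝ) (φ : ℕ → ℝ → ℝ) (m₀ M₀ c₀ : ℝ) (φ₀ : ℝ → ℝ) :
    Prop where
  profile : ∀ i, IsProfile (m i) (M i) (c i) (φ i)
  profile₀ : IsProfile m₀ M₀ c₀ φ₀
  m_lim : Tendsto m atTop (𝓝 m₀)
  M_lim : Tendsto M atTop (𝓝 M₀)
  c_lim : Tendsto c atTop (𝓝 c₀)

namespace ConvergentProfiles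

variable {m M c : ℕ → ℝ} {φ : ℕ → ℝ → ℝ} {m₀ M₀ c₀ : ℝ} {φ₀ : ℝ → ℝ}

theorem top_lim (h : ConvergentProfiles m M c φ m₀ M₀ c₀ φ₀) :
    Tendsto (fun i => min (M i) (c i)) atTop (𝓝 (min M₀ c₀)) := h.M_lim.min h.c_lim

theorem eventually_lt (h : ConvergentProfiles m M c φ m₀ M₀ c₀ φ₀) {ρ : ℝ}
    (hρ : ρ < min M₀ c₀ - m₀) : ∀ᶠ i in atTop, ρ < min (M i) (c i) - m i :=
  (h.top_lim.sub h.m_lim).eventually_const_lt hρ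

theorem tendsto_speedSq (h : ConvergentProfiles m M c φ m₀ M₀ c₀ φ₀) {y : ℕ → ℝ} {y₀ : ℝ}
    (hy : Tendsto y atTop (𝓝 y₀)) (hne : y₀ ≠ c₀) :
    Tendsto (fun i => speedSq (m i) (M i) (c i) (y i)) atTop (𝓝 (speedSq m₀ M₀ c₀ y₀)) := by
  have hc : Continuous fun q : ℝ × ℝ × ℝ × ℝ => (q.2.1 - q.2.2.2) *
      cofactor q.1 q.2.1 q.2.2.1 q.2.2.2 := by unfold cofactor; fun_prop
  have h1 := (hc.tendsto (m₀, M₀, c₀, y₀)).comp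
    (h.m_lim.prodMk_nhds (h.M_lim.prodMk_nhds (h.c_lim.prodMk_nhds hy)))
  exact h1.div (h.c_lim.sub hy) (sub_ne_zero.2 hne.symm)

theorem tendsto_clockRate (h : ConvergentProfiles m M c φ m₀ M₀ c₀ φ₀) {s : ℝ} (h1 : 0 < s)
    (h2 : s < min M₀ c₀ - m₀) :
    Tendsto (fun i => clockRate (m i) (M i) (c i) s) atTop (𝓝 (clockRate m₀ M₀ c₀ s)) := by
  have hne : min M₀ c₀ - s ≠ c₀ := (by linarith [min_le_right M₀ c₀] : min M₀ c₀ - s < c₀).ne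
  have hF := h.tendsto_speedSq (h.top_lim.sub_const s) hne
  have hpos := h.profile₀.speedSq_pos (y := min M₀ c₀ - s) (by linarith) (by linarith)
  exact ((Real.continuous_sqrt.tendsto _).comp hF).inv₀ (Real.sqrt_pos.2 hpos).ne'

theorem exists_cofactor_ge (h : ConvergentProfiles m M c φ m₀ M₀ c₀ φ₀) {ρ : ℝ} (h1 : 0 ≤ ρ)
    (h2 : ρ < min M₀ c₀ - m₀) : ∃ κ, 0 < κ ∧ ∀ᶠ i in atTop, ∀ s ∈ Icc 0 ρ,
      κ ≤ cofactor (m i) (M i) (c i) (min (M i) (c i) - s) := by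
  set Ψ : (ℝ × ℝ × ℝ) × ℝ → ℝ :=
    fun q => cofactor q.1.1 q.1.2.1 q.1.2.2 (min q.1.2.1 q.1.2.2 - q.2) with hΨ
  have hcont : Continuous Ψ := by rw [hΨ]; unfold cofactor; fun_prop
  obtain ⟨s₀, hs₀, hmin⟩ := isCompact_Icc.exists_isMinOn (nonempty_Icc.2 h1)
    (f := fun s => Ψ ((m₀, M₀, c₀), s)) (by fun_prop)
  have hpos : 0 < Ψ ((m₀, M₀, c₀), s₀) :=
    h.profile₀.cofactor_pos _ (by linarith [hs₀.2]) (by linarith [hs₀.1])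
  refine ⟨Ψ ((m₀, M₀, c₀), s₀) / 2, half_pos hpos, ?_⟩
  have hev : ∀ᶠ p in 𝓝 (m₀, M₀, c₀), ∀ s ∈ Icc 0 ρ, Ψ ((m₀, M₀, c₀), s₀) / 2 ≤ Ψ (p, s) := by
    refine isCompact_Icc.eventually_forall_of_forall_eventually fun s hs => ?_
    have : Ψ ((m₀, M₀, c₀), s₀) / 2 < Ψ ((m₀, M₀, c₀), s) := (half_lt_self hpos).trans_le (hmin hs)
    exact (hcont.continuousAt.eventually_const_lt this).mono fun z hz => hz.le
  exact (h.m_lim.prodMk_nhds (h.M_lim.prodMk_nhds h.c_lim)).eventually hev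

/-- Dominated convergence, with the majorant of `clockRate_le`; the lower bound on the cofactors is
uniform on $[0,\rho]$ for a fixed `ρ` beyond `t₀`. -/
theorem tendsto_clock (h : ConvergentProfiles m M c φ m₀ M₀ c₀ φ₀) {t : ℕ → ℝ} {t₀ : ℝ}
    (ht : Tendsto t atTop (𝓝 t₀)) (hnn : ∀ᶠ i in atTop, 0 ≤ t i) (hlt : t₀ < min M₀ c₀ - m₀) :
    Tendsto (fun i => clock (m i) (M i) (c i) (t i)) atTop (𝓝 (clock m₀ M₀ c₀ t₀)) := by
  obtain ⟨ρ, htρ, hρ⟩ := exists_between hlt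
  have ht₀ : 0 ≤ t₀ := ge_of_tendsto ht hnn
  have hρ0 : 0 ≤ ρ := ht₀.trans htρ.le
  obtain ⟨κ, hκ, hev⟩ := h.exists_cofactor_ge hρ0 hρ
  -- The indicator moves the varying endpoint into the integrand; pointwise convergence can fail
  -- only at $s=t_0$.
  have key : Tendsto (fun i => ∫ s in (0)..ρ,
      indicator {s | s ≤ t i} (clockRate (m i) (M i) (c i)) s) atTop
      (𝓝 (∫ s in (0)..ρ, indicator {s | s ≤ t₀} (clockRate m₀ M₀ c₀) s)) := by
    refine intervalIntegral.tendsto_integral_filter_of_dominated_convergence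
      (fun s => (√(κ / ((c₀ - min M₀ c₀ + 1) + ρ)))⁻¹ * s ^ (-(1 / 2) : ℝ)) ?_ ?_
      (intervalIntegrable_rpow_neg_half _ _ _) ?_
    · exact Eventually.of_forall fun i =>
        ((measurable_clockRate _ _ _).indicator measurableSet_Iic).aestronglyMeasurable
    · filter_upwards [hev, (h.c_lim.sub h.top_lim).eventually_lt_const
        (lt_add_one (c₀ - min M₀ c₀))] with i hi hA
      refine Eventually.of_forall fun s hs => ?_
      rw [uIoc_of_le hρ0] at hs
      refine (norm_indicator_le_norm_self _ _).trans ?_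
      have h0 : 0 ≤ clockRate (m i) (M i) (c i) s := inv_nonneg.2 (Real.sqrt_nonneg _)
      rw [Real.norm_of_nonneg h0]
      exact clockRate_le hκ hs.1 hs.2 hA.le (hi s ⟨hs.1.le, hs.2⟩)
    · have hne : ∀ᵐ s : ℝ, s ≠ t₀ := by simp [ae_iff]
      filter_upwards [hne] with s hs hsρ
      rw [uIoc_of_le hρ0] at hsρ
      have hk := h.tendsto_clockRate hsρ.1 (hsρ.2.trans_lt hρ)
      rcases hs.lt_or_gt with hlt | hgt
      · rw [indicator_of_mem (show s ∈ {s | s ≤ t₀} from hlt.le)]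
        refine hk.congr' ?_
        filter_upwards [ht.eventually_const_lt hlt] with i hi
        rw [indicator_of_mem (show s ∈ {s | s ≤ t i} from hi.le)]
      · rw [indicator_of_notMem (show s ∉ {s | s ≤ t₀} from not_le.2 hgt)]
        refine tendsto_const_nhds.congr' ?_
        filter_upwards [ht.eventually_lt_const hgt] with i hi
        rw [indicator_of_notMem (show s ∉ {s | s ≤ t i} from not_le.2 hi)]
  rw [intervalIntegral.integral_indicator ⟨ht₀, htρ.le⟩] at key
  refine key.congr' ?_
  filter_upwards [hnn, ht.eventually_lt_const htρ] with i h1 h2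
  rw [intervalIntegral.integral_indicator ⟨h1, h2.le⟩, clock]

end ConvergentProfiles

theorem IsProfile.deriv_eq {m M c : ℝ} {φ : ℝ → ℝ} (h : IsProfile m M c φ) {ξ σ : ℝ}
    (hσ : σ ^ 2 = 1) (h1 : φ ξ ≠ c) (h2 : 0 < -(σ * deriv φ ξ)) :
    deriv φ ξ = -(σ * √(speedSq m M c (φ ξ))) := by
  rw [← h.deriv_sq ξ h1, show deriv φ ξ ^ 2 = (-(σ * deriv φ ξ)) ^ 2 by
      rw [neg_sq, mul_pow, hσ, one_mul], Real.sqrt_sq h2.le]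
  linear_combination (-deriv φ ξ) * hσ

theorem IsProfile.top_eq {m M c : ℝ} {φ : ℝ → ℝ} (h : IsProfile m M c φ) {ξ : ℝ} (hξ : φ ξ = c) :
    φ ξ = min M c :=
  le_antisymm (h.le ξ) (hξ ▸ min_le_right M (φ ξ))

namespace ConvergentProfiles

variable {m M c : ℕ → ℝ} {φ : ℕ → ℝ → ℝ} {m₀ M₀ c₀ : ℝ} {φ₀ : ℝ → ℝ}

/-- Convergence of tops implies convergence of `(φ, φ')` next to them. -/
theorem tendsto_of_tops (h : ConvergentProfiles m M c φ m₀ M₀ c₀ φ₀) {ρ σ x₀ ξ : ℝ} {x : ℕ → ℝ}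
    (hρ0 : 0 < ρ) (hρ : ρ < min M₀ c₀ - m₀) (hσ : σ = 1 ∨ σ = -1)
    (hx₀ : φ₀ x₀ = min M₀ c₀) (hx : ∀ᶠ i in atTop, φ i (x i) = min (M i) (c i))
    (hlim : Tendsto x atTop (𝓝 x₀)) (h1 : 0 < σ * (ξ - x₀))
    (h2 : σ * (ξ - x₀) < clock m₀ M₀ c₀ ρ) :
    Tendsto (fun i => φ i ξ) atTop (𝓝 (φ₀ ξ)) ∧
      Tendsto (fun i => deriv (φ i) ξ) atTop (𝓝 (deriv φ₀ ξ)) := by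
  have hσ2 : σ ^ 2 = 1 := by rcases hσ with rfl | rfl <;> norm_num
  obtain ⟨d1, d2, d3, d4⟩ := h.profile₀.descent hρ0 hρ hx₀ hσ ξ h1 h2
  have hclock : ∀ t, 0 ≤ t → t ≤ ρ →
      Tendsto (fun i => clock (m i) (M i) (c i) t) atTop (𝓝 (clock m₀ M₀ c₀ t)) := fun t a b =>
    h.tendsto_clock tendsto_const_nhds (Eventually.of_forall fun _ => a) (b.trans_lt hρ)
  have htime : Tendsto (fun i => σ * (ξ - x i)) atTop (𝓝 (σ * (ξ - x₀))) :=
    (hlim.const_sub ξ).const_mul σ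
  have hev : ∀ᶠ i in atTop, φ i ξ < min (M i) (c i) ∧ min (M i) (c i) - ρ < φ i ξ ∧
      0 < -(σ * deriv (φ i) ξ) ∧
        clock (m i) (M i) (c i) (min (M i) (c i) - φ i ξ) = σ * (ξ - x i) := by
    filter_upwards [hx, h.eventually_lt hρ, htime.eventually_const_lt h1,
      htime.eventually_lt (hclock ρ hρ0.le le_rfl) h2] with i i1 i2 i3 i4
    exact (h.profile i).descent hρ0 i2 i1 hσ ξ i3 i4
  have hmono₀ := h.profile₀.strictMonoOn_clock hρ0.le hρ
  -- Inverse functions of converging increasing functions converge: a depth on either side of the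
  -- limit is compared with the true depth through their clock values.
  have hw : Tendsto (fun i => min (M i) (c i) - φ i ξ) atTop (𝓝 (min M₀ c₀ - φ₀ ξ)) := by
    have hmem₀ : min M₀ c₀ - φ₀ ξ ∈ Icc 0 ρ := ⟨by linarith, by linarith⟩
    rw [tendsto_order]
    constructor
    · intro a ha
      rcases le_or_gt a 0 with ha0 | ha0
      · filter_upwards [hev] with i hi
        linarith [hi.1]
      · have hamem : a ∈ Icc 0 ρ := ⟨ha0.le, by linarith⟩
        have hlt : clock m₀ M₀ c₀ a < σ * (ξ - x₀) := d4 ▸ hmono₀ hamem hmem₀ ha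
        filter_upwards [hev, h.eventually_lt hρ, (hclock a hamem.1 hamem.2).eventually_lt htime hlt]
          with i hi hiρ hi2
        rw [← hi.2.2.2] at hi2
        exact (((h.profile i).strictMonoOn_clock hρ0.le hiρ).lt_iff_lt hamem
          ⟨by linarith [hi.1], by linarith [hi.2.1]⟩).1 hi2
    · intro b hb
      rcases le_or_gt ρ b with hbρ | hbρ
      · filter_upwards [hev] with i hi
        linarith [hi.2.1]
      · have hbmem : b ∈ Icc 0 ρ := ⟨by linarith, hbρ.le⟩
        have hlt : σ * (ξ - x₀) < clock m₀ M₀ c₀ b := d4 ▸ hmono₀ hmem₀ hbmem hb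
        filter_upwards [hev, h.eventually_lt hρ, htime.eventually_lt (hclock b hbmem.1 hbmem.2) hlt]
          with i hi hiρ hi2
        rw [← hi.2.2.2] at hi2
        exact (((h.profile i).strictMonoOn_clock hρ0.le hiρ).lt_iff_lt
          ⟨by linarith [hi.1], by linarith [hi.2.1]⟩ hbmem).1 hi2
  have hφ : Tendsto (fun i => φ i ξ) atTop (𝓝 (φ₀ ξ)) := by
    simpa using h.top_lim.sub hw
  refine ⟨hφ, ?_⟩
  have hne₀ : φ₀ ξ ≠ c₀ := (d1.trans_le (min_le_right _ _)).ne
  rw [h.profile₀.deriv_eq hσ2 hne₀ d3]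
  refine ((((Real.continuous_sqrt.tendsto _).comp
    (h.tendsto_speedSq hφ hne₀)).const_mul σ).neg).congr' ?_
  filter_upwards [hev] with i hi
  exact ((h.profile i).deriv_eq hσ2 (hi.1.trans_le (min_le_right _ _)).ne hi.2.2.1).symm

/-- Convergence of `(φ, φ')` next to a top of the limit implies convergence of tops. -/
theorem exists_tops_of_tendsto (h : ConvergentProfiles m M c φ m₀ M₀ c₀ φ₀) {ρ σ x₀ ξ : ℝ}
    (hρ0 : 0 < ρ) (hρ : ρ < min M₀ c₀ - m₀) (hσ : σ = 1 ∨ σ = -1)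
    (hx₀ : φ₀ x₀ = min M₀ c₀) (h1 : 0 < σ * (ξ - x₀)) (h2 : σ * (ξ - x₀) < clock m₀ M₀ c₀ ρ)
    (hφ : Tendsto (fun i => φ i ξ) atTop (𝓝 (φ₀ ξ)))
    (hφ' : Tendsto (fun i => deriv (φ i) ξ) atTop (𝓝 (deriv φ₀ ξ))) :
    ∃ x : ℕ → ℝ, (∀ᶠ i in atTop, φ i (x i) = min (M i) (c i)) ∧ Tendsto x atTop (𝓝 x₀) := by
  have hσ2 : σ ^ 2 = 1 := by rcases hσ with rfl | rfl <;> norm_num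
  obtain ⟨d1, d2, d3, d4⟩ := h.profile₀.descent hρ0 hρ hx₀ hσ ξ h1 h2
  -- The witness is the point where the branch through `ξ` returns to its top.
  refine ⟨fun i => ξ - σ * clock (m i) (M i) (c i) (min (M i) (c i) - φ i ξ), ?_, ?_⟩
  · filter_upwards [h.eventually_lt hρ, hφ.eventually_lt h.top_lim d1,
      (h.top_lim.sub_const ρ).eventually_lt hφ d2, (hφ'.const_mul σ).neg.eventually_const_lt d3]
      with i i1 i2 i3 i4
    exact (h.profile i).branch_end i1 hσ2 i2 i3 i4
  · have := h.tendsto_clock (h.top_lim.sub hφ)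
      (Eventually.of_forall fun i => sub_nonneg.2 ((h.profile i).le ξ)) (by linarith)
    have := (this.const_mul σ).const_sub ξ
    rw [d4] at this
    convert this using 2
    linear_combination (ξ - x₀) * hσ2

/-! ### Propagation of convergence along the line -/

/-- At `ξ` the profiles converge together with their derivatives or, if the limit has a crest
there, some of their tops converge to `ξ`. -/
def Tracks (M c : ℕ → ℝ) (φ : ℕ → ℝ → ℝ) (c₀ : ℝ) (φ₀ : ℝ → ℝ) (ξ : ℝ) : Prop :=
  (φ₀ ξ ≠ c₀ → Tendsto (fun i => φ i ξ) atTop (𝓝 (φ₀ ξ)) ∧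
    Tendsto (fun i => deriv (φ i) ξ) atTop (𝓝 (deriv φ₀ ξ))) ∧
  (φ₀ ξ = c₀ → ∃ x : ℕ → ℝ, (∀ᶠ i in atTop, φ i (x i) = min (M i) (c i)) ∧
    Tendsto x atTop (𝓝 ξ))

/-- The tracked points form an open and closed set containing $0$. Regular stretches are crossed by
the Gronwall argument; a crest of the limit is entered by recovering tops from a nearby point and
left by following the branches descending from those tops. -/
theorem tracks (h : ConvergentProfiles m M c φ m₀ M₀ c₀ φ₀)
    (h0 : ∀ i, φ i 0 = min (M i) (c i)) (h0₀ : φ₀ 0 = min M₀ c₀) (ξ : ℝ) :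
    Tracks M c φ c₀ φ₀ ξ := by
  obtain ⟨ρ, hρ0, hρ⟩ := exists_between (sub_pos.2 h.profile₀.m_lt)
  set ε := clock m₀ M₀ c₀ ρ with hε
  have hε0 : 0 < ε := by
    have := h.profile₀.strictMonoOn_clock hρ0.le hρ (left_mem_Icc.2 hρ0.le)
      (right_mem_Icc.2 hρ0.le) hρ0
    rwa [clock_zero] at this
  have hside : ∀ x η : ℝ, η ∈ Ioo (x - ε) (x + ε) → η ≠ x →
      ∃ σ : ℝ, (σ = 1 ∨ σ = -1) ∧ 0 < σ * (η - x) ∧ σ * (η - x) < ε := by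
    intro x η hη hne
    rcases hne.lt_or_gt with hlt | hgt
    · exact ⟨-1, Or.inr rfl, by linarith, by linarith [hη.1]⟩
    · exact ⟨1, Or.inl rfl, by linarith, by linarith [hη.2]⟩
  have hprop : ∀ x η, (∀ t ∈ uIcc x η, φ₀ t ≠ c₀) → Tracks M c φ c₀ φ₀ x →
      Tracks M c φ c₀ φ₀ η := by
    intro x η hne hx
    obtain ⟨t1, t2⟩ := hx.1 (hne x left_mem_uIcc)
    exact ⟨fun _ => tendsto_of_tendsto_uIcc h.profile h.profile₀ h.m_lim h.M_lim h.c_lim hne t1 t2,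
      fun hc => absurd hc (hne η right_mem_uIcc)⟩
  have hloc : ∀ x, φ₀ x ≠ c₀ → ∃ l r, x ∈ Ioo l r ∧ ∀ y ∈ Ioo l r, ∀ z ∈ Ioo l r,
      ∀ t ∈ uIcc y z, φ₀ t ≠ c₀ := by
    intro x hx
    obtain ⟨l, r, hlr, hsub⟩ := mem_nhds_iff_exists_Ioo_subset.1 (h.profile₀.isOpen.mem_nhds hx)
    exact ⟨l, r, hlr, fun y hy z hz t ht => hsub (ordConnected_Ioo.uIcc_subset hy hz ht)⟩
  have hopen : IsOpen {ξ | Tracks M c φ c₀ φ₀ ξ} := by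
    rw [isOpen_iff_mem_nhds]
    intro x hx
    by_cases hc : φ₀ x = c₀
    · obtain ⟨y, hy, hylim⟩ := hx.2 hc
      filter_upwards [Ioo_mem_nhds (sub_lt_self x hε0) (lt_add_of_pos_right x hε0)] with η hη
      by_cases hηx : η = x
      · rw [hηx]; exact hx
      · obtain ⟨σ, hσ, s1, s2⟩ := hside x η hη hηx
        have hx₀ := h.profile₀.top_eq hc
        have hlt := (h.profile₀.descent hρ0 hρ hx₀ hσ η s1 s2).1
        exact ⟨fun _ => h.tendsto_of_tops hρ0 hρ hσ hx₀ hy hylim s1 s2,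
          fun hc => absurd hc (hlt.trans_le (min_le_right _ _)).ne⟩
    · obtain ⟨l, r, hlr, hne⟩ := hloc x hc
      filter_upwards [Ioo_mem_nhds hlr.1 hlr.2] with η hη
      exact hprop x η (hne x hlr η hη) hx
  have hcl : closure {ξ | Tracks M c φ c₀ φ₀ ξ} ∩ univ ⊆ {ξ | Tracks M c φ c₀ φ₀ ξ} := by
    rintro x ⟨hx, -⟩
    by_cases hc : φ₀ x = c₀
    · obtain ⟨η, hη, hηt⟩ := mem_closure_iff_nhds.1 hx _
        (Ioo_mem_nhds (sub_lt_self x hε0) (lt_add_of_pos_right x hε0))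
      by_cases hηx : η = x
      · rw [← hηx]; exact hηt
      · obtain ⟨σ, hσ, s1, s2⟩ := hside x η hη hηx
        have hx₀ := h.profile₀.top_eq hc
        have hlt := (h.profile₀.descent hρ0 hρ hx₀ hσ η s1 s2).1
        obtain ⟨t1, t2⟩ := hηt.1 (hlt.trans_le (min_le_right _ _)).ne
        exact ⟨fun hne => absurd hc hne,
          fun _ => h.exists_tops_of_tendsto hρ0 hρ hσ hx₀ s1 s2 t1 t2⟩
    · obtain ⟨l, r, hlr, hne⟩ := hloc x hc
      obtain ⟨η, hη, hηt⟩ := mem_closure_iff_nhds.1 hx _ (Ioo_mem_nhds hlr.1 hlr.2)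
      exact hprop η x (hne η hη x hlr) hηt
  have hzero : Tracks M c φ c₀ φ₀ 0 := by
    refine ⟨fun _ => ⟨?_, ?_⟩, fun _ => ⟨fun _ => 0, Eventually.of_forall h0, tendsto_const_nhds⟩⟩
    · simp_rw [h0, h0₀]; exact h.top_lim
    -- This also holds at a peak or cusp of $\varphi_i$, where `deriv` takes its default value zero.
    · have e1 : ∀ i, deriv (φ i) 0 = 0 := fun i => IsLocalMax.deriv_eq_zero
        (Eventually.of_forall fun z => by rw [h0]; exact (h.profile i).le z)
      have e2 : deriv φ₀ 0 = 0 := IsLocalMax.deriv_eq_zero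
        (Eventually.of_forall fun z => by rw [h0₀]; exact h.profile₀.le z)
      simp_rw [e1, e2]; exact tendsto_const_nhds
  exact isPreconnected_univ.subset_of_closure_inter_subset hopen ⟨0, mem_univ _, hzero⟩ hcl
    (mem_univ ξ)

end ConvergentProfiles

/-! ### Strong convergence of derivatives and uniform convergence -/

/-- Pointwise convergence and convergence of the `L²` norms imply convergence in `L²`. -/
theorem tendsto_integral_sq_sub {α : Type*} [MeasurableSpace α] {μ : Measure α}
    {f : ℕ → α → ℝ} {f₀ : α → ℝ} (hf : ∀ i, MemLp (f i) 2 μ) (hf₀ : MemLp f₀ 2 μ)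
    (hae : ∀ᵐ x ∂μ, Tendsto (fun i => f i x) atTop (𝓝 (f₀ x)))
    (hint : Tendsto (fun i => ∫ x, f i x ^ 2 ∂μ) atTop (𝓝 (∫ x, f₀ x ^ 2 ∂μ))) :
    Tendsto (fun i => ∫ x, (f i x - f₀ x) ^ 2 ∂μ) atTop (𝓝 0) := by
  -- By the parallelogram identity $(f_i-f_0)^2\le 2f_i^2+2f_0^2-q_i$. The truncation makes $q_i$
  -- dominated by its own limit $4f_0^2$, so the integral of the right side tends to zero.
  set q : ℕ → α → ℝ := fun i x => min ((f i x + f₀ x) ^ 2) (4 * f₀ x ^ 2) with hq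
  have hb : Integrable (fun x => 4 * f₀ x ^ 2) μ := hf₀.integrable_sq.const_mul 4
  have hqm : ∀ i, AEStronglyMeasurable (q i) μ := fun i =>
    (((hf i).1.add hf₀.1).pow 2).inf hb.1
  have hq0 : ∀ i x, ‖q i x‖ ≤ 4 * f₀ x ^ 2 := fun i x => by
    rw [Real.norm_of_nonneg (le_min (sq_nonneg _) (by positivity))]
    exact min_le_right _ _
  have hqi : ∀ i, Integrable (q i) μ := fun i =>
    hb.mono' (hqm i) (Eventually.of_forall (hq0 i))
  have hlim : Tendsto (fun i => ∫ x, q i x ∂μ) atTop (𝓝 (∫ x, 4 * f₀ x ^ 2 ∂μ)) := by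
    refine tendsto_integral_of_dominated_convergence _ hqm hb
      (fun i => Eventually.of_forall (hq0 i)) ?_
    filter_upwards [hae] with x hx
    have := ((hx.add_const (f₀ x)).pow 2).min (tendsto_const_nhds (x := 4 * f₀ x ^ 2))
    convert this using 2
    rw [show (f₀ x + f₀ x) ^ 2 = 4 * f₀ x ^ 2 by ring, min_self]
  rw [integral_const_mul] at hlim
  have hup : Tendsto (fun i => 2 * ∫ x, f i x ^ 2 ∂μ + 2 * ∫ x, f₀ x ^ 2 ∂μ - ∫ x, q i x ∂μ)
      atTop (𝓝 0) := by
    have := ((hint.const_mul 2).add_const (2 * ∫ x, f₀ x ^ 2 ∂μ)).sub hlim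
    convert this using 2
    ring
  refine squeeze_zero (fun i => integral_nonneg fun x => sq_nonneg _) (fun i => ?_) hup
  have i1 := (hf i).integrable_sq.const_mul 2
  have i2 := hf₀.integrable_sq.const_mul 2
  rw [← integral_const_mul, ← integral_const_mul, ← integral_add i1 i2,
    ← integral_sub (f := fun x => 2 * f i x ^ 2 + 2 * f₀ x ^ 2) (i1.add i2) (hqi i)]
  refine integral_mono (g := fun x => 2 * f i x ^ 2 + 2 * f₀ x ^ 2 - q i x)
    ((hf i).sub hf₀).integrable_sq ((i1.add i2).sub (hqi i)) fun x => ?_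
  have : q i x ≤ (f i x + f₀ x) ^ 2 := min_le_left _ _
  simp only
  linarith [sq_nonneg (f i x), show (f i x - f₀ x) ^ 2 + (f i x + f₀ x) ^ 2 =
    2 * f i x ^ 2 + 2 * f₀ x ^ 2 by ring]

theorem MemL2loc.integrable_sq_mul {g ψ : ℝ → ℝ} (hg : MemL2loc g) (hψ : IsTest ψ) :
    Integrable fun x => g x ^ 2 * ψ x := by
  have hloc : LocallyIntegrable (fun x => g x ^ 2) volume := by
    rw [locallyIntegrable_iff]
    intro k hk
    obtain ⟨R, hR⟩ := hk.isBounded.subset_closedBall 0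
    rw [Real.closedBall_eq_Icc, zero_sub, zero_add] at hR
    exact IntegrableOn.mono_set (hg R).integrable_sq hR
  simpa [mul_comm] using
    hloc.integrable_smul_left_of_hasCompactSupport hψ.continuous hψ.2

theorem IsTest.sq {θ : ℝ → ℝ} (h : IsTest θ) : IsTest fun x => θ x ^ 2 :=
  ⟨h.1.pow 2, h.2.comp_left (g := fun y : ℝ => y ^ 2) (by simp)⟩

theorem MemL2loc.memLp_mul {g θ : ℝ → ℝ} (hg : MemL2loc g)
    (hm : AEStronglyMeasurable g volume) (hθ : IsTest θ) :
    MemLp (fun x => g x * θ x) 2 volume := by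
  refine (memLp_two_iff_integrable_sq (hm.mul hθ.continuous.aestronglyMeasurable)).2 ?_
  simpa only [Pi.mul_apply, mul_pow] using hg.integrable_sq_mul hθ.sq

theorem exists_isTest_eq_one (R : ℝ) : ∃ θ, IsTest θ ∧ ∀ x ∈ Icc (-R) R, θ x = 1 := by
  let b : ContDiffBump (0 : ℝ) :=
    { rIn := |R| + 1, rOut := |R| + 2, rIn_pos := by positivity, rIn_lt_rOut := by linarith }
  refine ⟨b, ⟨b.contDiff, b.hasCompactSupport⟩, fun x hx => b.one_of_mem_closedBall ?_⟩
  have h1 := hx.1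
  have h2 := hx.2
  have h3 := le_abs_self R
  rw [Real.closedBall_eq_Icc]
  constructor <;> simp only [b] <;> linarith

theorem IsProfile.countable_crests {m M c : ℝ} {φ : ℝ → ℝ} (h : IsProfile m M c φ) :
    {ξ | φ ξ = c}.Countable := by
  refine Countable.mono (fun ξ hξ => ?_)
    (countable_setOfPred_isolated_right_within (s := {ξ | φ ξ = min M c}))
  refine ⟨h.top_eq hξ, ?_⟩
  rw [← empty_mem_iff_bot, mem_nhdsWithin_iff_eventually]
  have := h.isolated ξ (h.top_eq hξ)
  rw [eventually_nhdsWithin_iff] at this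
  filter_upwards [this] with η hη hη'
  exact absurd hη'.1 (hη (ne_of_gt hη'.2))

theorem IsProfile.ae_ne {m M c : ℝ} {φ : ℝ → ℝ} (h : IsProfile m M c φ) :
    ∀ᵐ ξ, φ ξ ≠ c := by
  have := h.countable_crests.measure_zero volume
  simpa [ae_iff] using this

theorem IsProfile.ae_eq_deriv {m M c : ℝ} {φ g : ℝ → ℝ} (h : IsProfile m M c φ)
    (hg : IsH1locWith φ g) : ∀ᵐ ξ, g ξ = deriv φ ξ := by
  filter_upwards [h.ae_ne, hg.2.2.ae_eq_deriv h.isOpen h.smooth] with ξ h1 h2 using h2 h1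

theorem MemL2loc.intervalIntegrable {g : ℝ → ℝ} (hg : MemL2loc g) (a b : ℝ) :
    IntervalIntegrable g volume a b := by
  rw [intervalIntegrable_iff' (by finiteness)]
  have h1 : IntegrableOn g (Icc (-(|a| + |b|)) (|a| + |b|)) :=
    (hg (|a| + |b|)).integrable one_le_two
  refine h1.mono_set (ordConnected_Icc.uIcc_subset ⟨?_, ?_⟩ ⟨?_, ?_⟩)
  all_goals linarith [neg_abs_le a, le_abs_self a, neg_abs_le b, le_abs_self b, abs_nonneg a,
    abs_nonneg b]

/-- The derivative may blow up at cusps, but it is locally integrable and exists off a countable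
set, which suffices for the fundamental theorem of calculus for continuous `φ`. -/
theorem IsProfile.integral_weak_deriv {m M c : ℝ} {φ g : ℝ → ℝ} (h : IsProfile m M c φ)
    (hg : IsH1locWith φ g) (a b : ℝ) : ∫ x in a..b, g x = φ b - φ a := by
  have hae := h.ae_eq_deriv hg
  have hint : IntervalIntegrable (deriv φ) volume a b :=
    (hg.2.1.intervalIntegrable a b).congr_ae (ae_restrict_of_ae hae)
  rw [← integral_eq_of_hasDerivAt_off_countable φ (deriv φ) h.countable_crests
    h.continuous.continuousOn (fun x hx => h.hasDerivAt hx.2) hint]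
  exact intervalIntegral.integral_congr_ae (hae.mono fun x hx _ => hx)

namespace ConvergentProfiles

variable {m M c : ℕ → ℝ} {φ : ℕ → ℝ → ℝ} {m₀ M₀ c₀ : ℝ} {φ₀ : ℝ → ℝ}

/-- Convergence of integrals of functions of the wave against a test function. -/
theorem tendsto_integral_comp (h : ConvergentProfiles m M c φ m₀ M₀ c₀ φ₀)
    (hae : ∀ᵐ x, Tendsto (fun i => φ i x) atTop (𝓝 (φ₀ x))) {q : ℝ × ℝ → ℝ} (hq : Continuous q)
    {ψ : ℝ → ℝ} (hψ : IsTest ψ) :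
    Tendsto (fun i => ∫ x, q (φ i x, c i) * ψ x) atTop (𝓝 (∫ x, q (φ₀ x, c₀) * ψ x)) := by
  obtain ⟨C, hC⟩ := (isCompact_Icc (a := (m₀ - 1, c₀ - 1))
    (b := (min M₀ c₀ + 1, c₀ + 1))).exists_bound_of_continuousOn hq.continuousOn
  refine tendsto_integral_filter_of_dominated_convergence (fun x => C * ‖ψ x‖) ?_ ?_
    (hψ.integrable.norm.const_mul C) ?_
  · exact Eventually.of_forall fun i => ((hq.comp ((h.profile i).continuous.prodMk
      continuous_const)).mul hψ.continuous).aestronglyMeasurable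
  · filter_upwards [h.m_lim.eventually_const_lt (sub_one_lt m₀),
      h.top_lim.eventually_lt_const (lt_add_one _),
      h.c_lim.eventually (Ioo_mem_nhds (sub_one_lt c₀) (lt_add_one c₀))] with i i1 i2 i3
    refine Eventually.of_forall fun x => ?_
    rw [norm_mul]
    refine mul_le_mul_of_nonneg_right (hC _ ⟨⟨?_, i3.1.le⟩, ⟨?_, i3.2.le⟩⟩) (norm_nonneg _)
    · exact i1.le.trans ((h.profile i).ge x)
    · exact ((h.profile i).le x).trans i2.le
  · filter_upwards [hae] with x hx
    exact ((hq.tendsto _).comp (hx.prodMk_nhds h.c_lim)).mul_const _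

variable {g : ℕ → ℝ → ℝ} {g₀ : ℝ → ℝ}

/-- The weak equation makes the weighted energies of the derivatives converge. -/
theorem tendsto_integral_sq_mul (h : ConvergentProfiles m M c φ m₀ M₀ c₀ φ₀)
    (hae : ∀ᵐ x, Tendsto (fun i => φ i x) atTop (𝓝 (φ₀ x)))
    (hg : ∀ i, IsH1locWith (φ i) (g i)) (hg₀ : IsH1locWith φ₀ g₀)
    (hw : ∀ i, WeakWaveEq (c i) (linCoeff (m i) (M i) (c i)) (φ i) (g i))
    (hw₀ : WeakWaveEq c₀ (linCoeff m₀ M₀ c₀) φ₀ g₀) {ψ : ℝ → ℝ} (hψ : IsTest ψ) :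
    Tendsto (fun i => ∫ x, g i x ^ 2 * ψ x) atTop (𝓝 (∫ x, g₀ x ^ 2 * ψ x)) := by
  -- Solving the weak equation for the energy term leaves only integrals of continuous functions of
  -- the wave, plus the constant term.
  have hsplit : ∀ {m M c : ℝ} {φ g : ℝ → ℝ}, IsProfile m M c φ → IsH1locWith φ g →
      WeakWaveEq c (linCoeff m M c) φ g → ∫ x, g x ^ 2 * ψ x =
        (∫ x, (φ x - c) ^ 2 * deriv (deriv ψ) x) + linCoeff m M c * (∫ x, ψ x) -
          ∫ x, (2 * φ x ^ 3 - 2 * c * φ x) * ψ x := by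
    intro m M c φ g h hg hw
    have e := hw ψ hψ
    have i1 := hg.2.1.integrable_sq_mul hψ
    have i2 : Integrable fun x => (2 * φ x ^ 3 - 2 * c * φ x) * ψ x := by
      refine Continuous.integrable_of_hasCompactSupport ?_ hψ.2.mul_left
      have := h.continuous; have := hψ.continuous; fun_prop
    have e2 : ∀ x, (g x ^ 2 + 2 * φ x ^ 3 - 2 * c * φ x) * ψ x =
        g x ^ 2 * ψ x + (2 * φ x ^ 3 - 2 * c * φ x) * ψ x := fun x => by ring
    simp_rw [e2] at e
    rw [integral_add i1 i2, integral_const_mul] at e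
    linarith
  simp_rw [fun i => hsplit (h.profile i) (hg i) (hw i)]
  rw [hsplit h.profile₀ hg₀ hw₀]
  have t1 := h.tendsto_integral_comp hae (q := fun p => (p.1 - p.2) ^ 2) (by fun_prop)
    hψ.deriv.deriv
  have t2 := h.tendsto_integral_comp hae (q := fun p => 2 * p.1 ^ 3 - 2 * p.2 * p.1)
    (by fun_prop) hψ
  have t3 : Tendsto (fun i => linCoeff (m i) (M i) (c i)) atTop (𝓝 (linCoeff m₀ M₀ c₀)) := by
    have hc : Continuous fun p : ℝ × ℝ × ℝ => linCoeff p.1 p.2.1 p.2.2 := by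
      unfold linCoeff; fun_prop
    exact (hc.tendsto (m₀, M₀, c₀)).comp (h.m_lim.prodMk_nhds (h.M_lim.prodMk_nhds h.c_lim))
  exact (t1.add (t3.mul_const _)).sub t2

/-- The derivatives converge in `L²` on bounded intervals. -/
theorem tendsto_eLpNorm_deriv (h : ConvergentProfiles m M c φ m₀ M₀ c₀ φ₀)
    (hae : ∀ᵐ x, Tendsto (fun i => φ i x) atTop (𝓝 (φ₀ x)))
    (haeg : ∀ᵐ x, Tendsto (fun i => g i x) atTop (𝓝 (g₀ x)))
    (hg : ∀ i, IsH1locWith (φ i) (g i)) (hg₀ : IsH1locWith φ₀ g₀)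
    (hw : ∀ i, WeakWaveEq (c i) (linCoeff (m i) (M i) (c i)) (φ i) (g i))
    (hw₀ : WeakWaveEq c₀ (linCoeff m₀ M₀ c₀) φ₀ g₀) (R : ℝ) :
    Tendsto (fun i => eLpNorm (g i - g₀) 2 (volume.restrict (Icc (-R) R))) atTop (𝓝 0) := by
  obtain ⟨θ, hθ, hθ1⟩ := exists_isTest_eq_one R
  have hL := fun i => (hg i).2.1.memLp_mul (hg i).2.2.2.1.aestronglyMeasurable hθ
  have hL₀ := hg₀.2.1.memLp_mul hg₀.2.2.2.1.aestronglyMeasurable hθ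
  have key := tendsto_integral_sq_sub hL hL₀
    (haeg.mono fun x hx => hx.mul_const (θ x))
    -- The test function is $\theta^2$, since $(g\theta)^2=g^2\theta^2$; this turns convergence of
    -- weighted energies into convergence of $L^2$ norms.
    (by simpa only [mul_pow] using h.tendsto_integral_sq_mul hae hg hg₀ hw hw₀ hθ.sq)
  have hbound : ∀ i, eLpNorm (g i - g₀) 2 (volume.restrict (Icc (-R) R)) ≤
      ENNReal.ofReal ((∫ x, (g i x * θ x - g₀ x * θ x) ^ 2) ^ (2⁻¹ : ℝ)) := by
    intro i
    have hmem : MemLp (fun x => g i x * θ x - g₀ x * θ x) 2 volume := (hL i).sub hL₀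
    have e1 : eLpNorm (g i - g₀) 2 (volume.restrict (Icc (-R) R)) =
        eLpNorm (fun x => g i x * θ x - g₀ x * θ x) 2 (volume.restrict (Icc (-R) R)) := by
      refine eLpNorm_congr_ae ((ae_restrict_iff' measurableSet_Icc).2
        (Eventually.of_forall fun x hx => ?_))
      simp [hθ1 x hx]
    rw [e1]
    refine (eLpNorm_mono_measure _ Measure.restrict_le_self).trans_eq ?_
    rw [hmem.eLpNorm_eq_integral_rpow_norm two_ne_zero ENNReal.ofNat_ne_top]
    simp
  refine tendsto_of_tendsto_of_tendsto_of_le_of_le tendsto_const_nhds ?_ (fun i => zero_le) hbound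
  have := ENNReal.tendsto_ofReal (key.rpow_const (p := (2⁻¹ : ℝ)) (Or.inr (by norm_num)))
  simpa using this

/-- Convergence of the derivatives in `L²` and convergence at one point imply locally uniform
convergence. -/
theorem tendstoUniformlyOn_Icc (h : ConvergentProfiles m M c φ m₀ M₀ c₀ φ₀)
    (hae : ∀ᵐ x, Tendsto (fun i => φ i x) atTop (𝓝 (φ₀ x)))
    (hg : ∀ i, IsH1locWith (φ i) (g i)) (hg₀ : IsH1locWith φ₀ g₀)
    (hL : ∀ R : ℝ,
      Tendsto (fun i => eLpNorm (g i - g₀) 2 (volume.restrict (Icc (-R) R))) atTop (𝓝 0))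
    (R : ℝ) : TendstoUniformlyOn φ φ₀ atTop (Icc (-R) R) := by
  obtain ⟨z, hz⟩ := hae.exists
  -- The interval is enlarged to contain `z`, the point of convergence from which the derivatives
  -- are integrated.
  set S := max R |z| with hS
  have hzS : z ∈ Icc (-S) S := abs_le.1 (le_max_right R |z|)
  have hRS : Icc (-R) R ⊆ Icc (-S) S :=
    Icc_subset_Icc (neg_le_neg (le_max_left _ _)) (le_max_left _ _)
  set μ := volume.restrict (Icc (-S) S) with hμ
  have hmem : ∀ i, MemLp (g i - g₀) 2 μ := fun i => ((hg i).2.1 S).sub (hg₀.2.1 S)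
  have hL1 : Tendsto (fun i => ∫ x, ‖(g i - g₀) x‖ ∂μ) atTop (𝓝 0) := by
    have e1 : Tendsto (fun i => eLpNorm (g i - g₀) 1 μ) atTop (𝓝 0) := by
      have hfin : μ univ ^ (1 / (1 : ENNReal).toReal - 1 / (2 : ENNReal).toReal) ≠ ⊤ := by
        refine ENNReal.rpow_ne_top_of_nonneg (by norm_num) ?_
        rw [hμ, Measure.restrict_apply_univ]; exact measure_Icc_lt_top.ne
      refine tendsto_of_tendsto_of_tendsto_of_le_of_le tendsto_const_nhds ?_
        (fun i => zero_le) fun i =>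
        eLpNorm_le_eLpNorm_mul_rpow_measure_univ one_le_two (hmem i).1
      simpa using ENNReal.Tendsto.mul_const (hL S) (Or.inr hfin)
    have e2 := (ENNReal.tendsto_toReal ENNReal.zero_ne_top).comp e1
    refine e2.congr fun i => ?_
    rw [integral_norm_eq_lintegral_enorm (hmem i).1, Function.comp_apply,
      eLpNorm_one_eq_lintegral_enorm]
  have hsum : Tendsto (fun i => |φ i z - φ₀ z| + ∫ x, ‖(g i - g₀) x‖ ∂μ) atTop (𝓝 0) := by
    simpa using ((hz.sub_const (φ₀ z)).abs).add hL1
  rw [Metric.tendstoUniformlyOn_iff]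
  intro ε hε
  filter_upwards [hsum.eventually_lt_const hε] with i hi x hx
  refine lt_of_le_of_lt ?_ hi
  have f1 := (h.profile i).integral_weak_deriv (hg i) z x
  have f2 := h.profile₀.integral_weak_deriv hg₀ z x
  have f3 : ∫ y in z..x, (g i y - g₀ y) = (φ i x - φ i z) - (φ₀ x - φ₀ z) := by
    rw [intervalIntegral.integral_sub ((hg i).2.1.intervalIntegrable z x)
      (hg₀.2.1.intervalIntegrable z x), f1, f2]
  have hsub : uIoc z x ⊆ Icc (-S) S :=
    uIoc_subset_uIcc.trans (ordConnected_Icc.uIcc_subset hzS (hRS hx))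
  have f4 : |∫ y in z..x, (g i y - g₀ y)| ≤ ∫ y, ‖(g i - g₀) y‖ ∂μ := by
    rw [← Real.norm_eq_abs]
    refine (intervalIntegral.norm_integral_le_integral_norm_uIoc).trans ?_
    exact setIntegral_mono_set ((hmem i).integrable one_le_two).norm
      (Eventually.of_forall fun _ => norm_nonneg _) hsub.eventuallyLE
  rw [dist_comm, Real.dist_eq]
  have f5 : φ i x - φ₀ x = (φ i z - φ₀ z) + ∫ y in z..x, (g i y - g₀ y) := by rw [f3]; ring
  rw [f5]
  exact (abs_add_le _ _).trans (add_le_add le_rfl f4)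

end ConvergentProfiles

theorem tendsto_eLpNorm_of_tendstoUniformlyOn {φ : ℕ → ℝ → ℝ} {φ₀ : ℝ → ℝ} {R : ℝ}
    (h : TendstoUniformlyOn φ φ₀ atTop (Icc (-R) R)) :
    Tendsto (fun i => eLpNorm (φ i - φ₀) 2 (volume.restrict (Icc (-R) R))) atTop (𝓝 0) := by
  set V := (volume.restrict (Icc (-R) R)) univ ^ (2 : ENNReal).toReal⁻¹ with hV
  have hVfin : V ≠ ⊤ := by
    refine ENNReal.rpow_ne_top_of_nonneg (by norm_num) ?_
    rw [Measure.restrict_apply_univ]; exact measure_Icc_lt_top.ne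
  have hb : ∀ ε > 0, ∀ᶠ i in atTop, eLpNorm (φ i - φ₀) 2 (volume.restrict (Icc (-R) R)) ≤
      V * ENNReal.ofReal ε := by
    intro ε hε
    filter_upwards [Metric.tendstoUniformlyOn_iff.1 h ε hε] with i hi
    refine eLpNorm_le_of_ae_bound ((ae_restrict_iff' measurableSet_Icc).2
      (Eventually.of_forall fun x hx => ?_))
    have := hi x hx
    rw [dist_comm, Real.dist_eq] at this
    exact this.le
  rw [ENNReal.tendsto_nhds_zero]
  intro δ hδ
  have hlim : Tendsto (fun ε : ℝ => V * ENNReal.ofReal ε) (𝓝[>] 0) (𝓝 0) := by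
    have := ENNReal.Tendsto.const_mul (ENNReal.tendsto_ofReal
      ((tendsto_id (α := ℝ)).mono_left (nhdsWithin_le_nhds (a := 0) (s := Ioi 0))))
      (Or.inr hVfin)
    simpa using this
  obtain ⟨ε, hε1, hε0⟩ := ((hlim.eventually_le_const hδ).and self_mem_nhdsWithin).exists
  exact (hb ε hε0).mono fun i hi => hi.trans hε1

end MCH

theorem mainTheorem5 (m M c : ℕ → ℝ) (m₀ M₀ c₀ : ℝ) (φ : ℕ → ℝ → ℝ) (φ₀ : ℝ → ℝ)
    (hφ : ∀ i, MCH.IsWaveOf (m i) (M i) (c i) (φ i))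
    (hφ₀ : MCH.IsWaveOf m₀ M₀ c₀ φ₀)
    (hcen : ∀ i, MCH.IsCentered (m i) (M i) (c i) (φ i))
    (hcen₀ : MCH.IsCentered m₀ M₀ c₀ φ₀)
    (hlim : Tendsto (fun i => (m i, M i, c i)) atTop (𝓝 (m₀, M₀, c₀))) :
    MCH.TendstoH1loc φ φ₀ ∧
      ∀ K : Set ℝ, IsCompact K → TendstoUniformlyOn φ φ₀ atTop K := by
  have hp := fun i => (hφ i).isCrestedWave (hcen i)
  obtain ⟨hp₀, htop₀, g₀, hg₀, hw₀⟩ := hφ₀.isCrestedWave hcen₀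
  choose g hg hw using fun i => (hp i).2.2
  have h : MCH.ConvergentProfiles m M c φ m₀ M₀ c₀ φ₀ :=
    ⟨fun i => (hp i).1, hp₀, (continuous_fst.tendsto _).comp hlim,
      ((continuous_fst.comp continuous_snd).tendsto _).comp hlim,
      ((continuous_snd.comp continuous_snd).tendsto _).comp hlim⟩
  have htr := h.tracks (fun i => (hp i).2.1) htop₀
  have hae : ∀ᵐ x, Tendsto (fun i => φ i x) atTop (𝓝 (φ₀ x)) := by
    filter_upwards [hp₀.ae_ne] with x hx using ((htr x).1 hx).1
  have haeg : ∀ᵐ x, Tendsto (fun i => g i x) atTop (𝓝 (g₀ x)) := by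
    filter_upwards [hp₀.ae_ne, hp₀.ae_eq_deriv hg₀,
      ae_all_iff.2 fun i => (hp i).1.ae_eq_deriv (hg i)] with x hx h1 h2
    simp_rw [h1, h2]
    exact ((htr x).1 hx).2
  have hL := h.tendsto_eLpNorm_deriv hae haeg hg hg₀ hw hw₀
  have hU := h.tendstoUniformlyOn_Icc hae hg hg₀ hL
  refine ⟨⟨g, g₀, hg, hg₀, fun R =>
    ⟨MCH.tendsto_eLpNorm_of_tendstoUniformlyOn (hU R), hL R⟩⟩, fun K hK => ?_⟩
  obtain ⟨R, hR⟩ := hK.isBounded.subset_closedBall 0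
  rw [Real.closedBall_eq_Icc, zero_sub, zero_add] at hR
  exact (hU R).mono hR
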